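/- **Model and notation.** All graphs are finite, simple and undirected. In the synchronous message-passing (LOCAL) model on an $n$-vertex graph $G=(V,E)$, $n\ge 1$, the vertices carry distinct identity numbers from $\{1,\dots,n\}$. Initially every vertex knows only $n$, its own identity number and its private string of independent fair random bits. In every round each vertex that has not terminated sends a message to each neighbor, receives the messages that its neighbors sent, and updates its state; message size and local computation are unrestricted. The running time is the number of rounds until all vertices have terminated with an output. A *strong $(d,\ell)$-network-decomposition* of $G$ is a partition of $V$ into clusters such that every cluster $C$ has diameter at most $d$ in the induced subgraph $G(C)$, and such that the supergraph obtained by contracting every cluster (distinct clusters are adjacent if some edge of $G$ joins them) is $\lfloor\ell\rfloor$-colorable. A *proper $\ell$-labeling* of it assigns to each vertex the color of its cluster in a proper coloring of this supergraph with colors from $\{1,\dots,\lfloor \ell\rfloor\}$. An algorithm *computes* a decomposition with a labeling if each vertex outputs the name of its cluster (two vertices output the same name if and only if they are in the same cluster) and its label. Logarithms are to base $2$, and $\log^* n$ is the least number of times that $\log$ has to be applied, starting from $n$, to reach a value at most $1$. An algorithm with running time bound $T$ and a given task succeeds *with exponent $c$* if it always terminates within $T$ rounds and, on every $n$-vertex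 graph with every assignment of identity numbers, performs the task with probability at least $1-1/n^c$. **Theorem.** Let $c$ be an arbitrary non-negative integer. 1. For every real $\delta>0$ there are constants $d,T$ (depending only on $\delta$ and $c$) and a randomized distributed algorithm that, with exponent $c$ and within $T$ rounds, computes a strong $(d,n^{\delta})$-network-decomposition of an arbitrary $n$-vertex graph along with a proper $n^{\delta}$-labeling of it, for every $n\ge 1$. 2. There are a constant $K$ (depending only on $c$) and a randomized distributed algorithm with a parameter $k$ that, for all integers $k$ with $1\le k\le\log n$ and every $n$-vertex graph, with exponent $c$ and within $K\cdot 3^k\log^* n$ rounds computes a strong $(3^k,\;K k\, n^{2/k}\log^2 n)$-network-decomposition along with a proper $(K k\, n^{2/k}\log^2 n)$-labeling of it. 3. There are a constant $K$ (depending only on $c$) and a randomized distributed algorithm with a parameter $k$ that, for all integers $k$ with $1\le k\le\log n$ and every $n$-vertex graph, with exponent $c$ and within $K\cdot k\,3^k$ rounds computes a strong $(3^k,\;K k\, n^{2/k}\log n)$-network-decomposition along with a proper $(K k\, n^{2/k}\log n)$-labeling of it. -/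

import Mathlib

/-!  Strong network decompositions and the synchronous message-passing (LOCAL) model. -/

universe u

section Decomposition

variable {V : Type u}

/-- The supergraph obtained by contracting each cluster of the partition `P`: distinct clusters
are adjacent if and only if some edge of `G` joins them. -/
def clusterGraph (G : SimpleGraph V) (P : Setoid V) : SimpleGraph (Quotient P) where
  Adj a b := a ≠ b ∧ ∃ u v : V, Quotient.mk P u = a ∧ Quotient.mk P v = b ∧ G.Adj u v
  symm := ⟨by
    rintro a b ⟨hne, u, v, hu, hv, huv⟩
    exact ⟨hne.symm, v, u, hv, hu, huv.symm⟩⟩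
  loopless := ⟨fun _ h => h.1 rfl⟩

/-- The partition `P` of the vertices is a strong `(d, ℓ)`-network-decomposition of `G`: every
cluster has diameter at most `d` in the subgraph that it induces (in particular it is connected),
and the cluster supergraph is `ℓ`-colorable. -/
structure IsStrongNetworkDecomposition (G : SimpleGraph V) (P : Setoid V) (d : ℕ) (ℓ : ℝ) :
    Prop where
  diam_le : ∀ v : V, (G.induce {u : V | P u v}).ediam ≤ (d : ℕ∞)
  colorable : (clusterGraph G P).Colorable ⌊ℓ⌋₊

/-- `label` is a proper `ℓ`-labeling of the partition `P`: every vertex carries the color of its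
cluster in a proper coloring of the cluster supergraph, and all labels lie in `{1, …, ⌊ℓ⌋}`. -/
def IsProperLabeling (G : SimpleGraph V) (P : Setoid V) (label : V → ℕ) (ℓ : ℝ) : Prop :=
  (∃ φ : (clusterGraph G P).Coloring ℕ, ∀ v : V, label v = φ (Quotient.mk P v)) ∧
    ∀ v : V, 1 ≤ label v ∧ (label v : ℝ) ≤ ℓ

/-- The joint output of all vertices, where `out v` consists of a name for the cluster of `v` and
the label of `v`, describes a strong `(d, ℓ)`-network-decomposition (two vertices are in the same
cluster if and only if they output the same name) with a proper `ℓ`-labeling. -/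
def IsLabeledDecomposition (G : SimpleGraph V) (d : ℕ) (ℓ : ℝ) (out : V → ℕ × ℕ) : Prop :=
  IsStrongNetworkDecomposition G (Setoid.ker fun v => (out v).1) d ℓ ∧
    IsProperLabeling G (Setoid.ker fun v => (out v).1) (fun v => (out v).2) ℓ

end Decomposition

/-- The iterated logarithm: the least number of applications of `log₂` that bring `x` to a value
at most `1`. -/
noncomputable def logStar (x : ℝ) : ℕ :=
  sInf {i : ℕ | (Real.logb 2)^[i] x ≤ 1}

/-- A randomized distributed algorithm in the synchronous message-passing model, with outputs in
`Out`. Every vertex knows the number `n` of vertices, its own identity number and its private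
random bits, and nothing else about the network. Local computation and message sizes are
unrestricted. -/
structure DistributedAlgorithm (Out : Type) where
  State : Type
  Msg : Type
  /-- Number of random bits of each vertex in an `n`-vertex network. -/
  randBits : ℕ → ℕ
  /-- Initial state, from `n`, the identity number and the random bits of the vertex. -/
  init : (n : ℕ) → ℕ → (Fin (randBits n) → Bool) → State
  /-- Message that a vertex in a given state sends to its neighbor with a given identity number. -/
  send : State → ℕ → Msg
  /-- New state, from the current state and the messages just received, each of them paired with
  the identity number of the neighbor that sent it. -/
  step : State → Set (ℕ × Msg) → State
  /-- A vertex has terminated, with output `o`, when its state is mapped to `some o`. -/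
  output : State → Option Out

namespace DistributedAlgorithm

variable {Out : Type} {V : Type u} [Fintype V]

/-- An assignment of random bits to all vertices of the network. -/
abbrev Coins (A : DistributedAlgorithm Out) (V : Type u) [Fintype V] : Type u :=
  V → Fin (A.randBits (Fintype.card V)) → Bool

open Classical in
/-- The state of every vertex after a given number of synchronous rounds. In every round each
vertex that has not terminated sends one message to each neighbor, receives the messages of its
neighbors that have not terminated, and updates its state. -/
noncomputable def run (A : DistributedAlgorithm Out) (G : SimpleGraph V) (ident : V → ℕ)
    (ω : A.Coins V) : ℕ → V → A.State
  | 0 => fun v => A.init (Fintype.card V) (ident v) (ω v)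
  | t + 1 => fun v =>
      if A.output (run A G ident ω t v) = none then
        A.step (run A G ident ω t v)
          {p : ℕ × A.Msg | ∃ u : V, G.Adj u v ∧ A.output (run A G ident ω t u) = none ∧
            p = (ident u, A.send (run A G ident ω t u) (ident v))}
      else run A G ident ω t v

/-- Within `τ` rounds every vertex has terminated, and `out` is the joint output. -/
def TerminatesWith (A : DistributedAlgorithm Out) (G : SimpleGraph V) (ident : V → ℕ)
    (ω : A.Coins V) (τ : ℝ) (out : V → Out) : Prop :=
  ∃ T : ℕ, (T : ℝ) ≤ τ ∧ ∀ v : V, A.output (A.run G ident ω T v) = some (out v)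

/-- The probability of an event when all random bits are independent and fair. -/
noncomputable def prob (A : DistributedAlgorithm Out) (E : Set (A.Coins V)) : ℝ :=
  (Nat.card E : ℝ) / (Nat.card (A.Coins V) : ℝ)

end DistributedAlgorithm

/-- On every network with underlying graph `G` (whose `n` vertices carry distinct identity numbers
from `{1, …, n}`), the algorithm always terminates within `τ` rounds, and with probability at
least `1 - 1 / n ^ c` it computes a strong `(d, ℓ)`-network-decomposition of `G` along with a
proper `ℓ`-labeling. -/
def ComputesDecomposition {V : Type u} [Fintype V] (A : DistributedAlgorithm (ℕ × ℕ))
    (G : SimpleGraph V) (c d : ℕ) (ℓ τ : ℝ) : Prop :=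
  ∀ ident : V → ℕ, Function.Injective ident →
    (∀ v : V, 1 ≤ ident v ∧ ident v ≤ Fintype.card V) →
    (∀ ω : A.Coins V, ∃ out : V → ℕ × ℕ, A.TerminatesWith G ident ω τ out) ∧
    1 - 1 / (Fintype.card V : ℝ) ^ c ≤
      A.prob {ω : A.Coins V | ∃ out : V → ℕ × ℕ,
        A.TerminatesWith G ident ω τ out ∧ IsLabeledDecomposition G d ℓ out}

/-!
Instead of merging clusters level by level, all clusters are determined at once by shifted
distances. Let `q` be a power of two with `n ^ (1 / k) ≤ q ≤ 2 * n ^ (1 / k)`. Every vertex draws a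
level below `k`, which is at least `i` with probability `q ^ (-i)`, and a vertex of level `i` may
claim the ball of radius `r i = 3 ^ i - 1`. Every vertex `v` joins the vertex `u` for which
`r (level u) - dist v u` is largest. As usual for such clusters, a shortest path to the center stays
inside the cluster (`exists_walk_to_center`), so that the diameter is at most
`2 * r (k - 1) ≤ 3 ^ k`.

The radii satisfy `r (i + 1) = 3 * r i + 2`. Hence a vertex of level `i` with a vertex of larger
level within distance `2 * r i + 1` has an empty cluster (`radius_le_of_clusterCenter_eq`), while
all adjacent clusters of level `i` have centers within that distance. The balls do not depend on the
random levels, and a fixed ball rarely contains many vertices of level at least `i` and none of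
larger level (`uniformProb_no_higher_level_le`). So, with high probability, every center is in
conflict with only `D = O(q * log n)` vertices of its own level.

It remains to color each conflict graph, with palettes that are disjoint for different levels. In a
trial, every uncolored vertex draws `s` candidate colors, each from its own palette of size `M`,
and keeps one that is free; whatever the history, a trial fails for a given vertex with probability
at most `(D / M) ^ s` (`uniformProb_colorTrials_le`). A single trial with `s = O(log n)` and
`M ≥ 2 * D` needs `O(k * q * (log n) ^ 2)` colors and `O(3 ^ k)` rounds, which is the second claim;
`O(k)` trials with `s = 1` and `M ≥ q * D` need `O(k * q ^ 2 * log n)` colors and `O(k * 3 ^ k)`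
rounds, which is the third. The first claim is the third for a constant `k ≥ 4 / δ`, except for
boundedly many values of `n`, for which the connected components serve as clusters.

All these rules read off the output of a vertex from a ball around it. `gatherAlgorithm` turns any
such rule into a distributed algorithm whose running time is the radius of the ball: the state of a
vertex contains the set of all networks that are consistent with what it has heard.
-/

open SimpleGraph

/-! ### Indistinguishable networks -/

section Locality

variable {V S : Type*}

/-- `Agree G G' ω ω' t v` says that a vertex `v` cannot tell the network `G` with data `ω` from the
network `G'` with data `ω'` in `t` rounds of communication: the data agree on the ball of radius
`t` around `v`, and so do the neighborhoods of all vertices at distance less than `t`. -/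
def Agree (G G' : SimpleGraph V) (ω ω' : V → S) : ℕ → V → Prop
  | 0, v => ω v = ω' v
  | t + 1, v => Agree G G' ω ω' t v ∧ (∀ u, G.Adj v u ↔ G'.Adj v u) ∧
      ∀ u, G.Adj v u → Agree G G' ω ω' t u

variable {G G' : SimpleGraph V} {ω ω' : V → S}

theorem Agree.mono {s t : ℕ} (hst : s ≤ t) {v : V} (h : Agree G G' ω ω' t v) :
    Agree G G' ω ω' s v := by
  induction hst with
  | refl => exact h
  | step _ ih => exact ih h.1

theorem Agree.data_eq {t : ℕ} {v : V} (h : Agree G G' ω ω' t v) : ω v = ω' v :=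
  h.mono (Nat.zero_le t)

theorem Agree.symm {t : ℕ} {v : V} (h : Agree G G' ω ω' t v) : Agree G' G ω' ω t v := by
  induction t generalizing v with
  | zero => exact Eq.symm h
  | succ t ih =>
    exact ⟨ih h.1, fun u => (h.2.1 u).symm, fun u hu => ih (h.2.2 u ((h.2.1 u).2 hu))⟩

/-- Knowledge of the ball of radius `s + t` around `v` includes knowledge of the ball of radius `t`
around each vertex within distance `s`. -/
theorem Agree.of_walk {s t : ℕ} {u v : V} (p : G.Walk v u) (hp : p.length ≤ s)
    (h : Agree G G' ω ω' (s + t) v) :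
    Agree G G' ω ω' t u ∧ ∃ p' : G'.Walk v u, p'.length = p.length := by
  induction p generalizing s with
  | nil => exact ⟨h.mono (by omega), .nil, rfl⟩
  | cons hadj p ih =>
    rw [Walk.length_cons] at hp
    obtain ⟨s, rfl⟩ : ∃ s', s = s' + 1 := ⟨s - 1, by omega⟩
    have h' : Agree G G' ω ω' (s + t + 1) _ := h.mono (by omega)
    obtain ⟨h1, p', hp'⟩ := ih (by omega) (h'.2.2 _ hadj)
    exact ⟨h1, .cons ((h'.2.1 _).1 hadj) p', by simp [hp']⟩

theorem exists_walk_of_edist_le {u v : V} {s : ℕ} (h : G.edist v u ≤ s) :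
    ∃ p : G.Walk v u, p.length ≤ s := by
  obtain ⟨p, hp⟩ := exists_walk_of_edist_ne_top (h.trans_lt (ENat.natCast_lt_top s)).ne
  exact ⟨p, by exact_mod_cast hp.trans_le h⟩

theorem Agree.of_edist_le {s t : ℕ} {u v : V} (h : Agree G G' ω ω' (s + t) v)
    (hu : G.edist v u ≤ s) : Agree G G' ω ω' t u := by
  obtain ⟨p, hp⟩ := exists_walk_of_edist_le hu
  exact (h.of_walk p hp).1

theorem Agree.edist_le {s : ℕ} {u v : V} (h : Agree G G' ω ω' s v)
    (hu : G.edist v u ≤ s) : G'.edist v u ≤ G.edist v u := by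
  obtain ⟨p, hp⟩ := exists_walk_of_edist_ne_top (hu.trans_lt (ENat.natCast_lt_top s)).ne
  obtain ⟨-, p', hp'⟩ := Agree.of_walk (t := 0) p (by exact_mod_cast hp.trans_le hu) h
  rw [← hp, ← hp']
  exact SimpleGraph.edist_le p'

theorem Agree.edist_le_iff {s d : ℕ} {u v : V} (h : Agree G G' ω ω' s v) (hd : d ≤ s) :
    G.edist v u ≤ d ↔ G'.edist v u ≤ d := by
  have hd' : (d : ℕ∞) ≤ s := by exact_mod_cast hd
  exact ⟨fun hu => (h.edist_le (hu.trans hd')).trans hu,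
    fun hu => (h.symm.edist_le (hu.trans hd')).trans hu⟩

theorem Agree.dist_eq {s : ℕ} {u v : V} (h : Agree G G' ω ω' s v)
    (hu : G.edist v u ≤ s) : G.dist v u = G'.dist v u := by
  have h1 := h.edist_le hu
  have h2 := h.symm.edist_le (h1.trans hu)
  simp only [SimpleGraph.dist, le_antisymm h1 h2]

end Locality

/-- A rule by which every vertex of an `n`-vertex network, with random bits at the vertices,
determines an output from the ball of a given radius around it. The vertices are `Fin n`; the
identity number of `v` is `v + 1`. -/
structure LocalRule (n : ℕ) (Out : Type) where
  bits : ℕ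
  radius : ℕ
  rule : SimpleGraph (Fin n) → (Fin n → Fin bits → Bool) → Fin n → Out
  rule_eq : ∀ {G G' : SimpleGraph (Fin n)} {ω ω' : Fin n → Fin bits → Bool} {v : Fin n},
    Agree G G' ω ω' radius v → rule G ω v = rule G' ω' v

/-! ### Simulation of local rules by message passing -/

section Gather

variable {Out : Type} [Nonempty Out]

/-- A network with identity numbers and random bits at its vertices. -/
abbrev Network (bits : ℕ → ℕ) : Type :=
  Σ n : ℕ, SimpleGraph (Fin n) × (Fin n → Fin (bits n) → Bool)

/-- The knowledge of a vertex: the number of vertices, its identity number, the number of rounds so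
far, and the set of all networks that are consistent with what it has heard. -/
structure Knowledge (bits : ℕ → ℕ) : Type where
  size : ℕ
  ident : ℕ
  round : ℕ
  worlds : Set (Network bits)

open Classical in
/-- The algorithm in which every vertex sends everything that it knows to its neighbors until it
knows the ball on which its local rule depends, and then applies the rule to an arbitrary network
that is consistent with its knowledge. -/
noncomputable def gatherAlgorithm (R : ∀ n, LocalRule n Out) : DistributedAlgorithm Out where
  State := Knowledge fun n => (R n).bits
  Msg := Set (Network fun n => (R n).bits)
  randBits n := (R n).bits
  init n i x := ⟨n, i, 0, {N | ∃ G ω, ∃ v : Fin n, N = ⟨n, G, ω⟩ ∧ (v : ℕ) + 1 = i ∧ ω v = x}⟩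
  send σ _ := σ.worlds
  step σ M := ⟨σ.size, σ.ident, σ.round + 1,
    {N | N ∈ σ.worlds ∧ (∀ p ∈ M, N ∈ p.2) ∧ ∀ j, (∃ m, (j, m) ∈ M) ↔
      ∃ v u : Fin N.1, (v : ℕ) + 1 = σ.ident ∧ (u : ℕ) + 1 = j ∧ N.2.1.Adj v u}⟩
  output σ := if (R σ.size).radius ≤ σ.round then
      some (Classical.epsilon fun o => ∃ N ∈ σ.worlds, ∃ v : Fin N.1,
        (v : ℕ) + 1 = σ.ident ∧ (R N.1).rule N.2.1 N.2.2 v = o)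
    else none

variable {V : Type u} [Fintype V]

/-- After `t` rounds the worlds that a vertex deems possible include the actual network, and all
of them agree with it on the ball of radius `t`. -/
theorem gatherAlgorithm_run (R : ∀ n, LocalRule n Out) (G : SimpleGraph V) (ident : V → ℕ)
    (e : V ≃ Fin (Fintype.card V)) (he : ∀ v, (e v : ℕ) + 1 = ident v)
    (ω : (gatherAlgorithm R).Coins V) (t : ℕ) (ht : t ≤ (R (Fintype.card V)).radius) (v : V) :
    ∃ W, (gatherAlgorithm R).run G ident ω t v = ⟨Fintype.card V, ident v, t, W⟩ ∧
      ⟨Fintype.card V, G.comap e.symm, fun i => ω (e.symm i)⟩ ∈ W ∧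
      ∀ N ∈ W, ∃ G' ω', N = ⟨Fintype.card V, G', ω'⟩ ∧
        Agree (G.comap e.symm) G' (fun i => ω (e.symm i)) ω' t (e v) := by
  have hid : ∀ v, ∀ i : Fin (Fintype.card V), (i : ℕ) + 1 = ident v → i = e v :=
    fun v i hi => Fin.ext (by have := he v; omega)
  induction t generalizing v with
  | zero =>
    refine ⟨_, rfl, ⟨_, _, e v, rfl, he v, by simp only [Equiv.symm_apply_apply]; rfl⟩, ?_⟩
    rintro N ⟨G', ω', i, rfl, hi, hx⟩
    obtain rfl := hid v i hi
    exact ⟨G', ω', rfl, by simp [Agree, hx]⟩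
  | succ t ih =>
    have ih' := fun v => ih (by omega) v
    choose W hW hmem hagree using ih'
    -- All vertices terminate in the same round, so that nobody falls silent before.
    have hout : ∀ u, (gatherAlgorithm R).output ((gatherAlgorithm R).run G ident ω t u) = none := by
      intro u
      rw [hW u]
      simp only [gatherAlgorithm]
      rw [if_neg (by omega)]
    have hrun : (gatherAlgorithm R).run G ident ω (t + 1) v = (gatherAlgorithm R).step
        ⟨Fintype.card V, ident v, t, W v⟩ {p | ∃ u : V, G.Adj u v ∧
          (gatherAlgorithm R).output ((gatherAlgorithm R).run G ident ω t u) = none ∧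
          p = (ident u, (gatherAlgorithm R).send ((gatherAlgorithm R).run G ident ω t u)
            (ident v))} := (if_pos (hout v)).trans (by rw [hW v])
    refine ⟨_, hrun.trans rfl, ?_, ?_⟩
    · refine ⟨hmem v, ?_, ?_⟩
      · rintro p ⟨u, huv, -, rfl⟩
        rw [hW u]
        exact hmem u
      · intro j
        constructor
        · rintro ⟨m, u, huv, -, hp⟩
          obtain ⟨rfl, -⟩ := Prod.mk.inj hp
          exact ⟨e v, e u, he v, he u, by simpa using huv.symm⟩
        · rintro ⟨i, i', hi, rfl, hadj⟩
          obtain rfl := hid v i hi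
          obtain ⟨u, rfl⟩ := e.surjective i'
          rw [he u]
          exact ⟨_, u, by simpa using hadj.symm, hout u, rfl⟩
    · rintro N ⟨hN, hp, hadj⟩
      obtain ⟨G', ω', rfl, hA⟩ := hagree v N hN
      refine ⟨G', ω', rfl, hA, ?_, ?_⟩
      · intro i
        obtain ⟨u, rfl⟩ := e.surjective i
        have := hadj (ident u)
        constructor
        · intro h
          obtain ⟨x, y, hx, hy, hxy⟩ := this.1 ⟨_, u, by simpa using h.symm, hout u, rfl⟩
          obtain rfl := hid v x hx
          obtain rfl := hid u y hy
          exact hxy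
        · intro h
          obtain ⟨m, w, hw, -, hm⟩ := this.2 ⟨e v, e u, he v, he u, h⟩
          obtain ⟨h1, -⟩ := Prod.mk.inj hm
          obtain rfl : u = w := e.injective (Fin.ext (by have := he u; have := he w; omega))
          simpa using hw.symm
      · intro i hi
        obtain ⟨u, rfl⟩ := e.surjective i
        have := hp _ ⟨u, by simpa using hi.symm, hout u, rfl⟩
        rw [hW u] at this
        obtain ⟨G'', ω'', h1, h2⟩ := hagree u _ this
        obtain ⟨rfl, rfl⟩ := Prod.mk.inj (eq_of_heq (Sigma.mk.inj h1).2)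
        exact h2

/-- As all possible worlds agree on the ball that the rule reads, it does not matter to which of
them a vertex applies it. -/
theorem gatherAlgorithm_terminatesWith (R : ∀ n, LocalRule n Out) (G : SimpleGraph V)
    (ident : V → ℕ) (e : V ≃ Fin (Fintype.card V)) (he : ∀ v, (e v : ℕ) + 1 = ident v)
    (ω : (gatherAlgorithm R).Coins V) {τ : ℝ} (hτ : ((R (Fintype.card V)).radius : ℝ) ≤ τ) :
    (gatherAlgorithm R).TerminatesWith G ident ω τ fun v =>
      (R (Fintype.card V)).rule (G.comap e.symm) (fun i => ω (e.symm i)) (e v) := by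
  refine ⟨_, hτ, fun v => ?_⟩
  obtain ⟨W, hW, hmem, hagree⟩ := gatherAlgorithm_run R G ident e he ω _ le_rfl v
  rw [hW]
  simp only [gatherAlgorithm, le_refl, if_true, Option.some.injEq]
  have hspec := Classical.epsilon_spec (p := fun o => ∃ N ∈ W, ∃ i : Fin N.1,
    (i : ℕ) + 1 = ident v ∧ (R N.1).rule N.2.1 N.2.2 i = o) ⟨_, _, hmem, e v, he v, rfl⟩
  obtain ⟨N, hN, i, hi, hi'⟩ := hspec
  rw [← hi']
  obtain ⟨G', ω', rfl, hA⟩ := hagree N hN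
  obtain rfl : i = e v := Fin.ext (Nat.succ_injective (hi.trans (he v).symm))
  exact ((R _).rule_eq hA).symm

end Gather

/-! ### Labeled decompositions in terms of walks -/

section Output

variable {V W : Type*}

/-- A sufficient condition, in terms of walks, for `out` to describe a strong decomposition into
clusters of diameter at most `d` with a proper labeling by `{1, …, N}`. -/
structure IsClusterOutput (G : SimpleGraph V) (d N : ℕ) (out : V → ℕ × ℕ) : Prop where
  exists_walk : ∀ u v, (out u).1 = (out v).1 →
    ∃ p : G.Walk u v, p.length ≤ d ∧ ∀ w ∈ p.support, (out w).1 = (out u).1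
  label_eq : ∀ u v, (out u).1 = (out v).1 → (out u).2 = (out v).2
  label_ne : ∀ u v, G.Adj u v → (out u).1 ≠ (out v).1 → (out u).2 ≠ (out v).2
  label_pos : ∀ v, 1 ≤ (out v).2
  label_le : ∀ v, (out v).2 ≤ N

theorem IsClusterOutput.comap_equiv {G : SimpleGraph V} {d N : ℕ} {out : W → ℕ × ℕ} (e : V ≃ W)
    (h : IsClusterOutput (G.comap e.symm) d N out) : IsClusterOutput G d N fun v => out (e v) where
  exists_walk u v huv := by
    obtain ⟨p, hp, hs⟩ := h.exists_walk _ _ huv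
    let f : G.comap e.symm →g G := ⟨e.symm, id⟩
    refine ⟨(p.map f).copy (e.symm_apply_apply u) (e.symm_apply_apply v), by simpa using hp, ?_⟩
    intro w hw
    simp only [Walk.support_copy, Walk.support_map, List.mem_map] at hw
    obtain ⟨i, hi, rfl⟩ := hw
    rw [show e (f i) = i from e.apply_symm_apply i]
    exact hs i hi
  label_eq u v huv := h.label_eq _ _ huv
  label_ne u v huv hne := h.label_ne _ _ (by simpa using huv) hne
  label_pos v := h.label_pos _
  label_le v := h.label_le _

theorem IsClusterOutput.isLabeledDecomposition {G : SimpleGraph V} {d N : ℕ} {out : V → ℕ × ℕ}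
    (h : IsClusterOutput G d N out) {d' : ℕ} (hd : d ≤ d') {ℓ : ℝ} (hℓ : (N : ℝ) ≤ ℓ) :
    IsLabeledDecomposition G d' ℓ out := by
  let φ : (clusterGraph G (Setoid.ker fun v => (out v).1)).Coloring ℕ :=
    Coloring.mk (Quotient.lift (fun v => (out v).2) fun u v huv => h.label_eq u v huv) <| by
      rintro a b ⟨hne, u, v, rfl, rfl, huv⟩
      exact h.label_ne u v huv fun h' => hne (Quotient.sound h')
  refine ⟨⟨fun v => ?_, ?_⟩, ⟨φ, fun v => rfl⟩, fun v => ⟨h.label_pos v, ?_⟩⟩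
  · refine ediam_le_of_edist_le fun x y => ?_
    have hx : (out x).1 = (out v).1 := x.2
    have hy : (out y).1 = (out v).1 := y.2
    obtain ⟨p, hp, hs⟩ := h.exists_walk x y (hx.trans hy.symm)
    refine (SimpleGraph.edist_le (p.induce {u | (Setoid.ker fun v => (out v).1) u v}
      fun w hw => ((hs w hw).trans hx :))).trans ?_
    have hlen := congrArg Walk.length (Walk.map_induce p
      (s := {u | (Setoid.ker fun v => (out v).1) u v}) fun w hw => ((hs w hw).trans hx :))
    rw [Walk.length_map] at hlen
    rw [hlen]
    exact_mod_cast hp.trans hd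
  · have hN : N ≤ ⌊ℓ⌋₊ := Nat.le_floor hℓ
    refine ⟨Coloring.mk (fun a => ⟨φ a - 1, ?_⟩) ?_⟩
    · obtain ⟨v, rfl⟩ := Quotient.exists_rep a
      have h1 := h.label_pos v
      have h2 := h.label_le v
      change (out v).2 - 1 < _
      omega
    · intro a b hab heq
      have hne := φ.valid hab
      obtain ⟨u, rfl⟩ := Quotient.exists_rep a
      obtain ⟨v, rfl⟩ := Quotient.exists_rep b
      have h1 := h.label_pos u
      have h2 := h.label_pos v
      have h3 : (out u).2 - 1 = (out v).2 - 1 := congrArg Fin.val heq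
      exact hne (show (out u).2 = (out v).2 by omega)
  · exact le_trans (by exact_mod_cast h.label_le v) hℓ

end Output

/-! ### Clusters by shifted distances -/

section Clusters

variable {n : ℕ}

/-- The strength with which a vertex `u`, whose cluster may have radius at most `r u`, attracts
`v`: the radius that is left at `v`, with ties broken by the number of `u`. -/
noncomputable def attraction (G : SimpleGraph (Fin n)) (r : Fin n → ℕ) (v u : Fin n) : ℕ :=
  n * (r u - G.dist v u) + u

/-- Among all vertices whose radius reaches `v`, the vertex `u` attracts `v` most. -/
def IsCenter (G : SimpleGraph (Fin n)) (r : Fin n → ℕ) (v u : Fin n) : Prop :=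
  G.edist v u ≤ r u ∧ ∀ x, G.edist v x ≤ r x → attraction G r v x ≤ attraction G r v u

/-- The center of the cluster of `v`: the vertex that attracts `v` most. -/
noncomputable def clusterCenter (G : SimpleGraph (Fin n)) (r : Fin n → ℕ) (v : Fin n) : Fin n :=
  haveI : Nonempty (Fin n) := ⟨v⟩
  Classical.epsilon (IsCenter G r v)

variable {G G' : SimpleGraph (Fin n)} {r r' : Fin n → ℕ}

theorem isCenter_clusterCenter (G : SimpleGraph (Fin n)) (r : Fin n → ℕ) (v : Fin n) :
    IsCenter G r v (clusterCenter G r v) := by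
  classical
  obtain ⟨u, hu, hmax⟩ := Finset.exists_max_image
    (Finset.univ.filter fun u => G.edist v u ≤ r u) (attraction G r v) ⟨v, by simp⟩
  simp only [Finset.mem_filter, Finset.mem_univ, true_and] at hu hmax
  have : Nonempty (Fin n) := ⟨v⟩
  exact Classical.epsilon_spec (p := IsCenter G r v) ⟨u, hu, hmax⟩

theorem attraction_injective (G : SimpleGraph (Fin n)) (r : Fin n → ℕ) (v : Fin n) :
    Function.Injective (attraction G r v) := by
  intro x y h
  have := congrArg (· % n) h
  simp only [attraction, Nat.mul_add_mod, Nat.mod_eq_of_lt x.2, Nat.mod_eq_of_lt y.2] at this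
  exact Fin.ext this

theorem IsCenter.clusterCenter_eq {v u : Fin n} (h : IsCenter G r v u) : clusterCenter G r v = u :=
  have h' := isCenter_clusterCenter G r v
  attraction_injective G r v (le_antisymm (h.2 _ h'.1) (h'.2 _ h.1))

theorem dist_le_of_edist_le {V : Type*} {G : SimpleGraph V} {u v : V} {s : ℕ}
    (h : G.edist v u ≤ s) : G.dist v u ≤ s :=
  ENat.toNat_le_of_le_natCast h

theorem edist_le_of_dist_le {V : Type*} {G : SimpleGraph V} {u v : V} {s : ℕ}
    (hr : G.Reachable v u) (h : G.dist v u ≤ s) : G.edist v u ≤ s := by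
  rw [← hr.coe_dist_eq_edist]
  exact_mod_cast h

theorem reachable_of_edist_le {V : Type*} {G : SimpleGraph V} {u v : V} {s : ℕ}
    (h : G.edist v u ≤ s) : G.Reachable v u :=
  reachable_of_edist_ne_top (h.trans_lt (ENat.natCast_lt_top s)).ne

/-- The next vertex on a shortest path from a vertex to its center belongs to the same cluster:
its attraction to the center is larger by `n`, and to any other vertex it is larger by at most
`n`. -/
theorem IsCenter.step {v w u : Fin n} (h : IsCenter G r v u) (hvw : G.Adj v w)
    (hd : G.dist v u = G.dist w u + 1) : IsCenter G r w u := by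
  have hvu := dist_le_of_edist_le h.1
  have hwu : G.Reachable w u := hvw.symm.reachable.trans (reachable_of_edist_le h.1)
  have hkey : attraction G r w u = attraction G r v u + n := by
    have : r u - G.dist w u = (r u - G.dist v u) + 1 := by omega
    simp only [attraction, this]
    ring
  refine ⟨edist_le_of_dist_le hwu (by omega), fun x hx => ?_⟩
  have hxr := reachable_of_edist_le hx
  have hxd := dist_le_of_edist_le hx
  have hvx : G.Reachable v x := hvw.reachable.trans hxr
  have h1 : G.dist v x ≤ G.dist w x + 1 := by
    have := hvw.reachable.dist_triangle_left x
    rw [dist_eq_one_iff_adj.2 hvw] at this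
    omega
  by_cases hvr : G.dist v x ≤ r x
  · have h2 := h.2 x (edist_le_of_dist_le hvx hvr)
    rw [hkey]
    refine le_trans ?_ (Nat.add_le_add_right h2 n)
    have : r x - G.dist w x ≤ (r x - G.dist v x) + 1 := by omega
    have := Nat.mul_le_mul_left n this
    simp only [attraction]
    rw [mul_add] at this
    omega
  · -- If `x` does not reach `v`, then at `w` it has no radius left.
    have : r x - G.dist w x = 0 := by omega
    have hx := x.2
    rw [hkey]
    simp only [attraction, this]
    omega

/-- Clusters have radius at most the radius of their center, even inside the cluster. -/
theorem exists_walk_to_center (v u : Fin n) (h : IsCenter G r v u) :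
    ∃ p : G.Walk v u, p.length = G.dist v u ∧ ∀ w ∈ p.support, IsCenter G r w u := by
  generalize hd : G.dist v u = d
  induction d generalizing v with
  | zero =>
    obtain rfl : v = u := (reachable_of_edist_le h.1).dist_eq_zero_iff.1 hd
    exact ⟨.nil, rfl, by simpa using h⟩
  | succ d ih =>
    obtain ⟨p, hp⟩ := (reachable_of_edist_le h.1).exists_walk_length_eq_dist
    cases p with
    | nil => simp at hd
    | @cons _ w _ hvw p =>
      have h1 := G.dist_le p
      rw [Walk.length_cons, hd] at hp
      have h2 : G.dist v u ≤ G.dist w u + 1 := by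
        have := hvw.reachable.dist_triangle_left u
        rw [dist_eq_one_iff_adj.2 hvw] at this
        omega
      have hw := h.step hvw (by omega)
      obtain ⟨p', hp', hs⟩ := ih w hw (by omega)
      refine ⟨.cons hvw p', by simp [hp'], ?_⟩
      simpa using ⟨h, hs⟩

theorem clusterCenter_clusterCenter (v : Fin n) :
    clusterCenter G r (clusterCenter G r v) = clusterCenter G r v := by
  obtain ⟨p, -, hs⟩ := exists_walk_to_center v _ (isCenter_clusterCenter G r v)
  exact (hs _ p.end_mem_support).clusterCenter_eq

/-- A vertex near which there is a vertex of far larger radius has an empty cluster. -/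
theorem radius_le_of_clusterCenter_eq {a x : Fin n} (ha : clusterCenter G r a = a)
    (hx : G.edist a x ≤ (2 * r a + 1 : ℕ)) : r x ≤ 3 * r a + 1 := by
  by_contra! hlt
  have hc := isCenter_clusterCenter G r a
  rw [ha] at hc
  have hd := dist_le_of_edist_le hx
  have h := hc.2 x (edist_le_of_dist_le (reachable_of_edist_le hx) (by omega))
  have h1 : r a + 1 ≤ r x - G.dist a x := by omega
  have h2 := Nat.mul_le_mul_left n h1
  have h3 := a.2
  simp only [attraction, dist_self, Nat.sub_zero, mul_add] at h h2
  omega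

theorem Agree.comp {V S S' : Type*} {G G' : SimpleGraph V} {ω ω' : V → S} (f : S → S') {t : ℕ}
    {v : V} (h : Agree G G' ω ω' t v) : Agree G G' (f ∘ ω) (f ∘ ω') t v := by
  induction t generalizing v with
  | zero => exact congrArg f h
  | succ t ih => exact ⟨ih h.1, h.2.1, fun u hu => ih (h.2.2 u hu)⟩

/-- Which vertices reach `v`, and how much they attract it, depends on the ball whose radius is the
largest radius of a cluster. -/
theorem Agree.attraction_eq {R : ℕ} (hr : ∀ u, r u ≤ R) {v u : Fin n} (h : Agree G G' r r' R v)
    (hu : G.edist v u ≤ r u) :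
    G'.edist v u ≤ r' u ∧ attraction G r v u = attraction G' r' v u := by
  have huR : G.edist v u ≤ R := hu.trans (by exact_mod_cast hr u)
  have hdata : r u = r' u := (Agree.of_edist_le (t := 0) h huR).data_eq
  refine ⟨hdata ▸ (h.edist_le huR).trans hu, ?_⟩
  rw [attraction, attraction, h.dist_eq huR, hdata]

theorem Agree.clusterCenter_eq {R : ℕ} (hr : ∀ u, r u ≤ R) (hr' : ∀ u, r' u ≤ R) {v : Fin n}
    (h : Agree G G' r r' R v) : clusterCenter G r v = clusterCenter G' r' v := by
  have hc := isCenter_clusterCenter G' r' v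
  have h1 := h.symm.attraction_eq hr' hc.1
  refine IsCenter.clusterCenter_eq ⟨h1.1, fun x hx => ?_⟩
  have h2 := h.attraction_eq hr hx
  rw [h2.2, ← h1.2]
  exact hc.2 x h2.1

end Clusters

/-! ### Coloring by random trials -/

section Coloring

variable {V : Type*} {s M T : ℕ}

/-- The candidate color `(j, z v j)` of `v` is free: it is not the color of a neighbor, nor does an
uncolored neighbor have the same candidate. -/
def IsFree (H : SimpleGraph V) (σ : V → Option (Fin s × Fin M)) (z : V → Fin s → Fin M) (v : V)
    (j : Fin s) : Prop :=
  ∀ u, H.Adj v u → σ u ≠ some (j, z v j) ∧ (σ u = none → z u j ≠ z v j)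

open Classical in
/-- One trial of a random coloring with the colors `Fin s × Fin M`: every vertex `v` that is not yet
colored has the candidates `(j, z v j)`, and takes one that is free if there is any. -/
noncomputable def colorStep (H : SimpleGraph V) (σ : V → Option (Fin s × Fin M))
    (z : V → Fin s → Fin M) (v : V) : Option (Fin s × Fin M) :=
  if σ v = none then
    if h : ∃ j, IsFree H σ z v j then some (h.choose, z v h.choose) else none
  else σ v

/-- The partial coloring after `T` trials with the candidates `X`, starting with no vertex
colored. -/
noncomputable def colorTrials (H : SimpleGraph V) :
    (T : ℕ) → (Fin T → V → Fin s → Fin M) → V → Option (Fin s × Fin M)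
  | 0, _ => fun _ => none
  | T + 1, X => colorStep H (colorTrials H T (Fin.init X)) (X (Fin.last T))

/-- Properness of a partial coloring is preserved by a trial: two neighbors that are colored in the
same trial have different candidates, and an older color of a neighbor is avoided. -/
theorem colorStep_ne {H : SimpleGraph V} {σ : V → Option (Fin s × Fin M)}
    {z : V → Fin s → Fin M} (hσ : ∀ u v, H.Adj u v → σ u ≠ none → σ u ≠ σ v)
    (u v : V) (huv : H.Adj u v) (hu : colorStep H σ z u ≠ none) :
    colorStep H σ z u ≠ colorStep H σ z v := by
  classical
  intro heq
  have hv : colorStep H σ z v ≠ none := heq ▸ hu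
  unfold colorStep at heq hu hv
  by_cases h1 : σ u = none <;> by_cases h2 : σ v = none <;>
    simp only [h1, h2, if_true, if_false] at heq hu hv
  · split_ifs at heq hu hv with h3 h4
    · have hj := congrArg Prod.fst (Option.some.inj heq)
      have hx := congrArg Prod.snd (Option.some.inj heq)
      simp only at hj hx
      refine (h3.choose_spec v huv).2 h2 ?_
      rw [hx, hj]
    · simp at hv
  · split_ifs at heq hu with h3
    · exact (h3.choose_spec v huv).1 heq.symm
    · simp at hu
  · split_ifs at heq hv with h3
    · exact (h3.choose_spec u huv.symm).1 heq
    · simp at hv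
  · exact hσ u v huv h1 heq

theorem colorTrials_ne (H : SimpleGraph V) (X : Fin T → V → Fin s → Fin M) (u v : V)
    (huv : H.Adj u v) (hu : colorTrials H T X u ≠ none) :
    colorTrials H T X u ≠ colorTrials H T X v := by
  induction T generalizing u v with
  | zero => simp [colorTrials] at hu
  | succ T ih => exact colorStep_ne (fun u v huv hu => ih _ u v huv hu) u v huv hu

theorem colorStep_congr {H H' : SimpleGraph V} {σ σ' : V → Option (Fin s × Fin M)}
    {z z' : V → Fin s → Fin M} {v : V} (hH : ∀ u, H.Adj v u ↔ H'.Adj v u)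
    (hv : σ v = σ' v ∧ z v = z' v) (hu : ∀ u, H.Adj v u → σ u = σ' u ∧ z u = z' u) :
    colorStep H σ z v = colorStep H' σ' z' v := by
  have hfree : IsFree H σ z v = IsFree H' σ' z' v := by
    ext j
    unfold IsFree
    refine forall_congr' fun u => ?_
    rw [← hH u]
    refine imp_congr_right fun h => ?_
    rw [(hu u h).1, (hu u h).2, hv.2]
  unfold colorStep
  rw [hv.1, hv.2, hfree]

/-- Two centers are in conflict if their radii, hence their levels, are the same and they are so
close that their clusters may be adjacent. -/
def conflictGraph (G : SimpleGraph V) (r : V → ℕ) : SimpleGraph V where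
  Adj a b := a ≠ b ∧ r a = r b ∧ G.edist a b ≤ (2 * r a + 1 : ℕ)
  symm := ⟨fun _ _ ⟨h1, h2, h3⟩ => ⟨h1.symm, h2.symm, by rwa [edist_comm, ← h2]⟩⟩
  loopless := ⟨fun _ h => h.1 rfl⟩

variable {G G' : SimpleGraph V} {S : Type*} {ω ω' : V → S}

theorem Agree.conflictGraph_adj (ρ : S → ℕ) {R : ℕ} (hR : ∀ x, ρ x ≤ R) {v : V}
    (h : Agree G G' ω ω' (2 * R + 1) v) (u : V) (hadj : (conflictGraph G (ρ ∘ ω)).Adj v u) :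
    (conflictGraph G' (ρ ∘ ω')).Adj v u := by
  obtain ⟨h1, h2, h3⟩ := hadj
  have hle : 2 * (ρ ∘ ω) v + 1 ≤ 2 * R + 1 := by
    have := hR (ω v)
    simp only [Function.comp_apply]
    omega
  have hv : ω v = ω' v := h.data_eq
  have hu : ω u = ω' u :=
    (Agree.of_edist_le (t := 0) h (h3.trans (by exact_mod_cast hle))).data_eq
  refine ⟨h1, by simpa [← hv, ← hu] using h2, ?_⟩
  rw [h.edist_le_iff hle] at h3
  simpa [← hv] using h3

/-- Each trial depends on the conflicts of a vertex, hence on vertices at distance at most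
`2 * R + 1`. -/
theorem Agree.colorTrials_eq (ρ : S → ℕ) {R : ℕ} (hR : ∀ x, ρ x ≤ R)
    (χ : S → Fin T → Fin s → Fin M) {v : V} (h : Agree G G' ω ω' (T * (2 * R + 1)) v) :
    colorTrials (conflictGraph G (ρ ∘ ω)) T (fun t u => χ (ω u) t) v =
      colorTrials (conflictGraph G' (ρ ∘ ω')) T (fun t u => χ (ω' u) t) v := by
  induction T generalizing v with
  | zero => rfl
  | succ T ih =>
    rw [add_mul, one_mul, add_comm] at h
    refine colorStep_congr (fun u => ⟨?_, ?_⟩) ⟨?_, ?_⟩ fun u hu => ?_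
    · exact (h.mono (Nat.le_add_right _ _)).conflictGraph_adj ρ hR u
    · exact (h.mono (Nat.le_add_right _ _)).symm.conflictGraph_adj ρ hR u
    · exact ih (fun x t => χ x t.castSucc) (h.mono (Nat.le_add_left _ _))
    · simp only [h.data_eq]
    · have hle : 2 * (ρ ∘ ω) v + 1 ≤ 2 * R + 1 := by
        have := hR (ω v)
        simp only [Function.comp_apply]
        omega
      have h' := h.of_edist_le (hu.2.2.trans (by exact_mod_cast hle))
      exact ⟨ih (fun x t => χ x t.castSucc) h', by simp only [h'.data_eq]⟩

end Coloring

/-! ### The output of the cluster algorithm -/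

section Output

variable {n k s M T : ℕ} {S : Type*}

/-- The largest radius of a cluster of level `i`. The recursion `r (i + 1) = 3 * r i + 2` makes a
vertex of level `i + 1` dominate every vertex of level `i` within distance `2 * r i + 1`. -/
def levelRadius (i : ℕ) : ℕ := 3 ^ i - 1

theorem levelRadius_strictMono : StrictMono levelRadius := by
  refine strictMono_nat_of_lt_succ fun i => ?_
  have := Nat.one_le_pow i 3 (by norm_num)
  simp only [levelRadius, pow_succ]
  omega

theorem levelRadius_le (i : Fin k) : levelRadius i ≤ 3 ^ (k - 1) - 1 :=
  levelRadius_strictMono.monotone (by omega : (i : ℕ) ≤ k - 1)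

/-- The label of a cluster: its level and the color of its center, encoded in `{1, …, k * s * M}`;
the label is `1` if the center has remained uncolored. -/
def clusterLabel (i : Fin k) : Option (Fin s × Fin M) → ℕ
  | none => 1
  | some x => 1 + finProdFinEquiv (i, finProdFinEquiv x)

/-- The output of a vertex: the center of its cluster and the label of the cluster, if the data of
a vertex `u` give it the level `lev (ω u)` and the candidate colors `χ (ω u)`. -/
noncomputable def clusterOutput (lev : S → Fin k) (χ : S → Fin T → Fin s → Fin M)
    (G : SimpleGraph (Fin n)) (ω : Fin n → S) (v : Fin n) : ℕ × ℕ :=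
  let r := fun u => levelRadius (lev (ω u))
  let a := clusterCenter G r v
  (a, clusterLabel (lev (ω a))
    (colorTrials (conflictGraph G r) T (fun t u => χ (ω u) t) a))

theorem Agree.clusterOutput_eq (lev : S → Fin k) (χ : S → Fin T → Fin s → Fin M)
    {G G' : SimpleGraph (Fin n)} {ω ω' : Fin n → S} {v : Fin n}
    (h : Agree G G' ω ω' (3 ^ (k - 1) - 1 + T * (2 * (3 ^ (k - 1) - 1) + 1)) v) :
    clusterOutput lev χ G ω v = clusterOutput lev χ G' ω' v := by
  let ρ : S → ℕ := fun x => levelRadius (lev x)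
  have hρ : ∀ x, ρ x ≤ 3 ^ (k - 1) - 1 := fun x => levelRadius_le _
  have hc : clusterCenter G (ρ ∘ ω) v = clusterCenter G' (ρ ∘ ω') v :=
    ((h.mono (Nat.le_add_right _ _)).comp ρ).clusterCenter_eq (fun u => hρ _) fun u => hρ _
  have ha := h.of_edist_le ((isCenter_clusterCenter G (ρ ∘ ω) v).1.trans (by exact_mod_cast hρ _))
  have hcol := ha.colorTrials_eq ρ hρ χ
  refine Prod.ext (congrArg Fin.val hc) ?_
  change clusterLabel (lev (ω (clusterCenter G (ρ ∘ ω) v)))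
      (colorTrials (conflictGraph G (ρ ∘ ω)) T (fun t u => χ (ω u) t) (clusterCenter G (ρ ∘ ω) v)) =
    clusterLabel (lev (ω' (clusterCenter G' (ρ ∘ ω') v)))
      (colorTrials (conflictGraph G' (ρ ∘ ω')) T (fun t u => χ (ω' u) t)
        (clusterCenter G' (ρ ∘ ω') v))
  rw [← hc, hcol, ha.data_eq]

/-- The output is correct as soon as every center is colored. -/
theorem isClusterOutput_clusterOutput (lev : S → Fin k) (χ : S → Fin T → Fin s → Fin M)
    (G : SimpleGraph (Fin n)) (ω : Fin n → S)
    (h : ∀ a, clusterCenter G (fun u => levelRadius (lev (ω u))) a = a →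
      colorTrials (conflictGraph G fun u => levelRadius (lev (ω u))) T (fun t u => χ (ω u) t) a ≠
        none) :
    IsClusterOutput G (2 * (3 ^ (k - 1) - 1)) (k * (s * M)) (clusterOutput lev χ G ω) := by
  set r : Fin n → ℕ := fun u => levelRadius (lev (ω u)) with hr
  have hrle : ∀ u, r u ≤ 3 ^ (k - 1) - 1 := fun u => levelRadius_le _
  set col := colorTrials (conflictGraph G r) T (fun t u => χ (ω u) t) with hcol
  have hname : ∀ v, (clusterOutput lev χ G ω v).1 = (clusterCenter G r v : ℕ) := fun v => rfl
  have hlabel : ∀ v, (clusterOutput lev χ G ω v).2 =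
      clusterLabel (lev (ω (clusterCenter G r v))) (col (clusterCenter G r v)) := fun v => rfl
  have hsome : ∀ v, ∃ x, col (clusterCenter G r v) = some x := fun v =>
    Option.ne_none_iff_exists'.1 (h _ (clusterCenter_clusterCenter v))
  have hwalk : ∀ v, ∃ p : G.Walk v (clusterCenter G r v), p.length ≤ r (clusterCenter G r v) ∧
      ∀ w ∈ p.support, clusterCenter G r w = clusterCenter G r v := fun v => by
    have hc := isCenter_clusterCenter G r v
    obtain ⟨p, hp, hs⟩ := exists_walk_to_center v _ hc
    exact ⟨p, hp ▸ dist_le_of_edist_le hc.1, fun w hw => (hs w hw).clusterCenter_eq⟩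
  refine ⟨fun u v huv => ?_, fun u v huv => ?_, fun u v huv hne => ?_, fun v => ?_, fun v => ?_⟩
  · rw [hname, hname, Fin.val_inj] at huv
    obtain ⟨p, hp, hps⟩ := hwalk u
    obtain ⟨p', hp', hps'⟩ := hwalk v
    refine ⟨p.append (p'.reverse.copy huv.symm rfl), ?_, ?_⟩
    · rw [Walk.length_append, Walk.length_copy, Walk.length_reverse]
      have := hrle (clusterCenter G r u)
      have := hrle (clusterCenter G r v)
      omega
    · intro w hw
      rw [Walk.mem_support_append_iff, Walk.support_copy, Walk.support_reverse,
        List.mem_reverse] at hw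
      rw [hname, hname, Fin.val_inj]
      exact hw.elim (hps w) fun hw => (hps' w hw).trans huv.symm
  · rw [hname, hname, Fin.val_inj] at huv
    rw [hlabel, hlabel, huv]
  · rw [hname, hname, Ne, Fin.val_inj] at hne
    rw [hlabel, hlabel]
    intro heq
    obtain ⟨x, hx⟩ := hsome u
    obtain ⟨y, hy⟩ := hsome v
    simp only [hx, hy, clusterLabel, add_right_inj, Fin.val_inj, EmbeddingLike.apply_eq_iff_eq,
      Prod.mk.injEq] at heq
    have hru : r (clusterCenter G r u) = r (clusterCenter G r v) := by
      change levelRadius (lev (ω _)) = levelRadius (lev (ω _))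
      rw [heq.1]
    refine colorTrials_ne (conflictGraph G r) (fun t u => χ (ω u) t) (clusterCenter G r u)
      (clusterCenter G r v) ⟨hne, hru, ?_⟩ (h _ (clusterCenter_clusterCenter u))
      (hx.trans ((congrArg some heq.2).trans hy.symm))
    obtain ⟨p, hp, -⟩ := hwalk u
    obtain ⟨p', hp', -⟩ := hwalk v
    refine (SimpleGraph.edist_le (p.reverse.append (.cons huv p'))).trans ?_
    rw [Walk.length_append, Walk.length_reverse, Walk.length_cons]
    have : p.length + (p'.length + 1) ≤ 2 * r (clusterCenter G r u) + 1 := by omega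
    exact_mod_cast this
  · rw [hlabel]
    obtain ⟨x, hx⟩ := hsome v
    rw [hx]
    exact Nat.le_add_right _ _
  · rw [hlabel]
    obtain ⟨x, hx⟩ := hsome v
    rw [hx, clusterLabel]
    have := (finProdFinEquiv (lev (ω (clusterCenter G r v)), finProdFinEquiv x)).2
    omega

end Output

/-! ### Uniform probability on finite types -/

section UniformProbability

variable {Ω Ω' A B : Type*}

/-- The probability of the event `p` under the uniform distribution on the finite type `Ω`. -/
noncomputable def uniformProb (p : Ω → Prop) : ℝ :=
  (Nat.card {x // p x} : ℝ) / Nat.card Ω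

open Classical in
theorem uniformProb_eq_sum [Fintype Ω] (p : Ω → Prop) :
    uniformProb p = (∑ x, if p x then 1 else 0) / Fintype.card Ω := by
  rw [uniformProb, Nat.card_eq_fintype_card, Nat.card_eq_fintype_card, Finset.sum_boole,
    Fintype.card_subtype]

theorem uniformProb_congr (e : Ω ≃ Ω') (p : Ω' → Prop) :
    uniformProb (fun x => p (e x)) = uniformProb p := by
  rw [uniformProb, uniformProb, Nat.card_congr e,
    Nat.card_congr (e.subtypeEquiv (q := p) fun _ => Iff.rfl)]

theorem uniformProb_mono [Finite Ω] {p q : Ω → Prop} (h : ∀ x, p x → q x) :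
    uniformProb p ≤ uniformProb q := by
  unfold uniformProb
  gcongr
  exact Nat.card_le_card_of_injective _ (Subtype.impEmbedding p q h).injective

theorem uniformProb_not [Finite Ω] [Nonempty Ω] (p : Ω → Prop) :
    uniformProb (fun x => ¬ p x) = 1 - uniformProb p := by
  classical
  cases nonempty_fintype Ω
  have hpos : (Fintype.card Ω : ℝ) ≠ 0 := by positivity
  rw [uniformProb_eq_sum, uniformProb_eq_sum, eq_sub_iff_add_eq, ← add_div,
    ← Finset.sum_add_distrib, div_eq_one_iff_eq hpos]
  trans ∑ _x : Ω, (1 : ℝ)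
  · refine Finset.sum_congr rfl fun x _ => ?_
    by_cases h : p x <;> simp [h]
  · simp

theorem uniformProb_or_le [Finite Ω] (p q : Ω → Prop) :
    uniformProb (fun x => p x ∨ q x) ≤ uniformProb p + uniformProb q := by
  classical
  cases nonempty_fintype Ω
  rw [uniformProb_eq_sum, uniformProb_eq_sum, uniformProb_eq_sum, ← add_div,
    ← Finset.sum_add_distrib]
  gcongr with x
  by_cases h1 : p x <;> by_cases h2 : q x <;> simp [h1, h2]

theorem uniformProb_exists_le [Finite Ω] {ι : Type*} [Fintype ι] (p : ι → Ω → Prop) {ε : ℝ}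
    (h : ∀ i, uniformProb (p i) ≤ ε) :
    uniformProb (fun x => ∃ i, p i x) ≤ Fintype.card ι * ε := by
  classical
  cases nonempty_fintype Ω
  have hsum : uniformProb (fun x => ∃ i, p i x) ≤ ∑ i, uniformProb (p i) := by
    simp_rw [uniformProb_eq_sum]
    rw [← Finset.sum_div, Finset.sum_comm]
    gcongr with x
    split_ifs with hx
    · obtain ⟨i, hi⟩ := hx
      refine le_trans ?_ (Finset.single_le_sum (f := fun i => if p i x then (1 : ℝ) else 0)
        (fun i _ => by split_ifs <;> norm_num) (Finset.mem_univ i))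
      simp [hi]
    · exact Finset.sum_nonneg fun i _ => by split_ifs <;> norm_num
  refine hsum.trans ((Finset.sum_le_sum fun i _ => h i).trans ?_)
  simp

/-- If `q` depends on the first coordinate only, and the conditional probability of `p` is at most
`ε` for each first coordinate with `q`, then the probability of `p` is at most `ε` times that
of `q`. -/
theorem uniformProb_prod_le [Finite A] [Finite B] (p : A → B → Prop) (q : A → Prop) {ε : ℝ}
    (hpq : ∀ a b, p a b → q a) (h : ∀ a, q a → uniformProb (p a) ≤ ε) :
    uniformProb (fun x : A × B => p x.1 x.2) ≤ ε * uniformProb q := by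
  classical
  cases nonempty_fintype A
  cases nonempty_fintype B
  simp_rw [uniformProb_eq_sum] at *
  rw [Fintype.card_prod, Fintype.sum_prod_type, Nat.cast_mul, mul_comm (Fintype.card A : ℝ),
    ← div_div, Finset.sum_div, mul_div_assoc', Finset.mul_sum]
  gcongr with a
  by_cases ha : q a
  · simpa [ha] using h a ha
  · simp [ha, fun b => mt (hpq a b) ha]

theorem uniformProb_le_one [Finite Ω] (p : Ω → Prop) : uniformProb p ≤ 1 := by
  refine div_le_one_of_le₀ ?_ (Nat.cast_nonneg _)
  exact_mod_cast Nat.card_le_card_of_injective _ Subtype.val_injective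

end UniformProbability

/-! ### Failure probability of the trials -/

section TrialProbability

variable {V : Type*} [Finite V] {s M T D : ℕ}

/-- In one trial, each of the `s` candidates of a vertex is excluded with probability at most
`D / M`, whatever the candidates of the other vertices are. -/
theorem uniformProb_colorStep_le {H : SimpleGraph V} {v : V} (hD : (H.neighborSet v).ncard ≤ D)
    (σ : V → Option (Fin s × Fin M)) (hσ : σ v = none) :
    uniformProb (fun z => colorStep H σ z v = none) ≤ ((D : ℝ) / M) ^ s := by
  classical
  cases nonempty_fintype V
  rw [← uniformProb_congr (Equiv.funSplitAt v (Fin s → Fin M)).symm,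
    ← uniformProb_congr (Equiv.prodComm _ _)]
  -- The candidates of the other vertices are fixed.
  refine (uniformProb_prod_le (fun w y => colorStep H σ
    ((Equiv.funSplitAt v (Fin s → Fin M)).symm (y, w)) v = none) (fun _ => True)
    (fun _ _ _ => trivial) fun w _ => ?_).trans
    (mul_le_of_le_one_right (by positivity) (uniformProb_le_one _))
  let f : Fin s → V → Option (Fin M) := fun j u => match σ u with
    | none => if hu : u ≠ v then some (w ⟨u, hu⟩ j) else none
    | some x => some x.2
  -- Each neighbor excludes at most one candidate from the palette `j`: its color, or else its own
  -- candidate.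
  let F : Fin s → Finset (Fin M) := fun j =>
    Finset.univ.filter fun c => some c ∈ (H.neighborFinset v).image (f j)
  have hF : ∀ j, (F j).card ≤ D := fun j => by
    refine le_trans ?_ hD
    rw [← Nat.card_coe_set_eq, Nat.card_eq_fintype_card, card_neighborSet_eq_degree,
      ← card_neighborFinset_eq_degree]
    refine le_trans ?_ (Finset.card_image_le (s := H.neighborFinset v) (f := f j))
    exact Finset.card_le_card_of_injOn some (fun c hc => (Finset.mem_filter.1 hc).2)
      (Option.some_injective _).injOn
  have hsub : ∀ y : Fin s → Fin M,
      colorStep H σ ((Equiv.funSplitAt v (Fin s → Fin M)).symm (y, w)) v = none →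
        y ∈ Fintype.piFinset F := by
    intro y hy
    unfold colorStep at hy
    rw [if_pos hσ] at hy
    split_ifs at hy with hfree
    rw [Fintype.mem_piFinset]
    intro j
    have hj : ¬ IsFree H σ _ v j := fun h => hfree ⟨j, h⟩
    unfold IsFree at hj
    push Not at hj
    obtain ⟨u, hu, hj⟩ := hj
    have huv : u ≠ v := hu.ne'
    have hv : (Equiv.funSplitAt v (Fin s → Fin M)).symm (y, w) v = y := by
      simp [Equiv.funSplitAt, Equiv.piSplitAt]
    have hu' : (Equiv.funSplitAt v (Fin s → Fin M)).symm (y, w) u = w ⟨u, huv⟩ := by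
      simp [Equiv.funSplitAt, Equiv.piSplitAt, huv]
    simp only [hv, hu'] at hj
    refine Finset.mem_filter.2 ⟨Finset.mem_univ _, Finset.mem_image.2
      ⟨u, (mem_neighborFinset _ _ _).2 hu, ?_⟩⟩
    by_cases h1 : σ u = some (j, y j)
    · simp [f, h1]
    · obtain ⟨h2, h3⟩ := hj h1
      simp [f, h2, huv, h3]
  refine (uniformProb_mono hsub).trans ?_
  rw [uniformProb, Nat.card_eq_fintype_card, Fintype.card_coe, Fintype.card_piFinset,
    Nat.card_eq_fintype_card, Fintype.card_fun, Fintype.card_fin, Fintype.card_fin, div_pow]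
  push_cast
  gcongr
  calc ∏ j, ((F j).card : ℝ) ≤ ∏ _j : Fin s, (D : ℝ) :=
        Finset.prod_le_prod (fun _ _ => by positivity) fun j _ => by exact_mod_cast hF j
    _ = (D : ℝ) ^ s := by simp

/-- A vertex with at most `D` neighbors remains uncolored in a trial with probability at most
`(D / M) ^ s`, independently of the history. -/
theorem uniformProb_colorTrials_le {H : SimpleGraph V} {v : V}
    (hD : (H.neighborSet v).ncard ≤ D) :
    uniformProb (fun X : Fin T → V → Fin s → Fin M => colorTrials H T X v = none) ≤
      (((D : ℝ) / M) ^ s) ^ T := by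
  induction T with
  | zero => simpa using uniformProb_le_one _
  | succ T ih =>
    rw [← uniformProb_congr (Fin.snocEquiv fun _ => V → Fin s → Fin M),
      ← uniformProb_congr (Equiv.prodComm _ _)]
    have heq : ∀ x : (Fin T → V → Fin s → Fin M) × (V → Fin s → Fin M),
        colorTrials H (T + 1) (Fin.snocEquiv (fun _ => V → Fin s → Fin M) (Equiv.prodComm _ _ x)) =
          colorStep H (colorTrials H T x.1) x.2 := fun x => by
      simp [colorTrials, Fin.snocEquiv]
    simp_rw [heq]
    refine (uniformProb_prod_le (fun X z => colorStep H (colorTrials H T X) z v = none)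
      (fun X => colorTrials H T X v = none) (fun X z h => ?_)
      fun X hX => uniformProb_colorStep_le hD _ hX).trans ?_
    · by_contra hne
      rw [colorStep, if_neg hne] at h
      exact hne h
    · rw [pow_succ, mul_comm]
      gcongr

end TrialProbability

/-! ### Random levels -/

section LevelProbability

variable {V : Type*} [Finite V] {q k : ℕ}

/-- The level of a vertex that has drawn `y` from `{0, …, q ^ k - 1}`: it is at least `i` with
probability `q ^ (-i)`, for `i < k`. -/
def sampleLevel (q k : ℕ) [NeZero k] (y : Fin (q ^ k)) : Fin k :=
  ⟨k - 1 - Nat.log q y, by have := Nat.pos_of_neZero k; omega⟩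

/-- The Markov inequality for a product of independent nonnegative factors. -/
theorem uniformProb_le_of_prod_weight {A : Type*} [Fintype A] [Nonempty A]
    (g : A → ℝ) (hg : ∀ x, 0 ≤ g x) {δ : ℝ} (hδ : 0 ≤ δ)
    (hsum : ∑ x, g x ≤ Fintype.card A * (1 + δ)) (B : Finset V) (p : (V → A) → Prop) {c : ℝ}
    (hc : 0 < c) (hp : ∀ y, p y → c ≤ ∏ w ∈ B, g (y w)) :
    uniformProb p ≤ (1 + δ) ^ Nat.card V / c := by
  classical
  cases nonempty_fintype V
  have hcard : (0 : ℝ) < Fintype.card (V → A) := by positivity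
  rw [uniformProb_eq_sum, le_div_iff₀ hc, div_mul_eq_mul_div, div_le_iff₀ hcard, Finset.sum_mul]
  calc ∑ y : V → A, (if p y then (1 : ℝ) else 0) * c
      ≤ ∑ y : V → A, ∏ w, (if w ∈ B then g (y w) else 1) := by
        gcongr with y
        rw [Finset.prod_ite_mem, Finset.univ_inter]
        split_ifs with h
        · simpa using hp y h
        · simpa using Finset.prod_nonneg fun w _ => hg (y w)
    _ = ∏ w : V, ∑ x : A, (if w ∈ B then g x else 1) := by
        rw [Finset.prod_univ_sum, Fintype.piFinset_univ]
    _ ≤ ∏ _w : V, (Fintype.card A * (1 + δ)) := by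
        refine Finset.prod_le_prod (fun w _ => Finset.sum_nonneg fun x _ => ?_) fun w _ => ?_
        · split_ifs
          exacts [hg x, zero_le_one]
        · split_ifs
          · exact hsum
          · simp only [Finset.sum_const, Finset.card_univ, nsmul_eq_mul, mul_one]
            nlinarith [(Fintype.card A).cast_nonneg (α := ℝ)]
    _ = (1 + δ) ^ Nat.card V * Fintype.card (V → A) := by
        rw [Finset.prod_const, Finset.card_univ, mul_pow, Fintype.card_fun,
          Nat.card_eq_fintype_card]
        push_cast
        ring

open Classical in
/-- If at least `D` vertices of a set `B` have level at least `i`, then it is unlikely that all of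
them have level exactly `i`. With `λ = q / (q - 1)`, the product over `B` of the weights `0` (level
above `i`), `λ` (level `i`) and `1` (level below `i`) has expectation at most `exp 2`. -/
theorem uniformProb_no_higher_level_le (hq : 2 ≤ q) [NeZero k] (hV : Nat.card V ≤ q ^ k)
    (B : Finset V) (i : Fin k) {D X : ℕ} (hD : q * X ≤ D) :
    uniformProb (fun y : V → Fin (q ^ k) => (∀ w ∈ B, sampleLevel q k (y w) ≤ i) ∧
      D ≤ (B.filter fun w => sampleLevel q k (y w) = i).card) ≤ 8 * (1 / 2) ^ X := by
  have hq' : (2 : ℝ) ≤ q := by exact_mod_cast hq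
  have hq1 : (0 : ℝ) < q - 1 := by linarith
  have hQ : 0 < q ^ k := by positivity
  have : Nonempty (Fin (q ^ k)) := ⟨⟨0, hQ⟩⟩
  set lam : ℝ := q / (q - 1) with hlam
  have hlam1 : 1 ≤ lam := by rw [hlam, le_div_iff₀ hq1]; linarith
  have hlam2 : lam ≤ 2 := by rw [hlam, div_le_iff₀ hq1]; linarith
  set g : Fin (q ^ k) → ℝ := fun x => if i < sampleLevel q k x then 0 else
    if sampleLevel q k x = i then lam else 1 with hg
  have hg0 : ∀ x, 0 ≤ g x := fun x => by
    simp only [hg]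
    split_ifs <;> linarith
  have hsum : ∑ x, g x ≤ Fintype.card (Fin (q ^ k)) * (1 + 2 / (q : ℝ) ^ k) := by
    -- Level `i` means `L ≤ x < q ^ (j + 1)`; for `j = 0` this includes `x = 0`, as
    -- `Nat.log q 0 = 0`.
    obtain ⟨j, hj⟩ : ∃ j, j + i + 1 = k := ⟨k - 1 - i, by omega⟩
    set L := if j = 0 then 0 else q ^ j with hL
    have hLU : L ≤ q ^ (j + 1) := by
      rw [hL]
      split_ifs
      exacts [Nat.zero_le _, Nat.pow_le_pow_right (by omega) (by omega)]
    have hUQ : q ^ (j + 1) ≤ q ^ k := Nat.pow_le_pow_right (by omega) (by omega)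
    let h : ℕ → ℝ := fun x =>
      if Nat.log q x < j then 0 else if Nat.log q x = j then lam else 1
    have hgh : ∀ x, g x = h x := fun x => by
      have hx : Nat.log q x < k :=
        Nat.log_lt_of_lt_pow' (NeZero.ne k) x.2
      have h1 : i < sampleLevel q k x ↔ Nat.log q x < j := by
        rw [Fin.lt_def, sampleLevel]
        simp only
        omega
      have h2 : sampleLevel q k x = i ↔ Nat.log q x = j := by
        rw [Fin.ext_iff, sampleLevel]
        simp only
        omega
      simp only [hg, h, h1, h2]
    have hlow : ∀ x ∈ Finset.Ico 0 L, h x = 0 := fun x hx => by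
      have hx := (Finset.mem_Ico.1 hx).2
      have hj0 : j ≠ 0 := by
        rintro rfl
        simp [hL] at hx
      rw [hL, if_neg hj0] at hx
      exact if_pos (Nat.log_lt_of_lt_pow' hj0 hx)
    have hmid : ∀ x ∈ Finset.Ico L (q ^ (j + 1)), h x = lam := fun x hx => by
      have hx := Finset.mem_Ico.1 hx
      have : Nat.log q x = j := by
        by_cases hj0 : j = 0
        · subst hj0
          exact Nat.log_of_lt (by simpa using hx.2)
        · rw [hL, if_neg hj0] at hx
          exact Nat.log_eq_of_pow_le_of_lt_pow hx.1 hx.2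
      simp [h, this]
    have hhigh : ∀ x ∈ Finset.Ico (q ^ (j + 1)) (q ^ k), h x = 1 := fun x hx => by
      have := Nat.le_log_of_pow_le (by omega) (Finset.mem_Ico.1 hx).1
      simp only [h]
      rw [if_neg (by omega), if_neg (by omega)]
    rw [Finset.sum_congr rfl fun x _ => hgh x, Fin.sum_univ_eq_sum_range h,
      Finset.range_eq_Ico, ← Finset.sum_Ico_consecutive h (Nat.zero_le L) (hLU.trans hUQ),
      ← Finset.sum_Ico_consecutive h hLU hUQ, Finset.sum_congr rfl hlow,
      Finset.sum_congr rfl hmid, Finset.sum_congr rfl hhigh]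
    simp only [Finset.sum_const, Nat.card_Ico, nsmul_eq_mul, Fintype.card_fin]
    rw [Nat.cast_sub hLU, Nat.cast_sub hUQ]
    have hmain : ((q ^ (j + 1) : ℕ) - (L : ℝ)) * lam - (q ^ (j + 1) : ℕ) ≤ 2 := by
      have hlam' : lam * (q - 1) = q := div_mul_cancel₀ _ hq1.ne'
      rw [hL]
      split_ifs with hj0
      · subst hj0
        push_cast
        nlinarith
      · have : ((q ^ (j + 1) : ℕ) - ((q ^ j : ℕ) : ℝ)) * lam - (q ^ (j + 1) : ℕ) =
            (q : ℝ) ^ j * (lam * (q - 1) - q) := by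
          push_cast
          ring
        rw [this, hlam']
        simp
    have : ((q ^ k : ℕ) : ℝ) * (1 + 2 / (q : ℝ) ^ k) = (q ^ k : ℕ) + 2 := by
      push_cast
      field_simp
    rw [this]
    linarith
  have hprob := uniformProb_le_of_prod_weight (V := V) g hg0 (by positivity) hsum B
    (fun y : V → Fin (q ^ k) => (∀ w ∈ B, sampleLevel q k (y w) ≤ i) ∧
      D ≤ (B.filter fun w => sampleLevel q k (y w) = i).card) (c := lam ^ D) (by positivity) ?_
  · refine hprob.trans ?_
    rw [div_eq_mul_inv]
    have h1 : (1 + 2 / (q : ℝ) ^ k) ^ Nat.card V ≤ 8 := by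
      calc (1 + 2 / (q : ℝ) ^ k) ^ Nat.card V ≤ (1 + 2 / (q : ℝ) ^ k) ^ (q ^ k) :=
            pow_le_pow_right₀ (by simp; positivity) hV
        _ ≤ (Real.exp (2 / (q : ℝ) ^ k)) ^ (q ^ k) := by
            gcongr
            rw [add_comm]
            exact Real.add_one_le_exp _
        _ = Real.exp 2 := by
            rw [← Real.exp_nat_mul]
            congr 1
            push_cast
            field_simp
        _ ≤ 8 := by
            have := Real.exp_one_lt_d9
            rw [show (2 : ℝ) = 1 + 1 by norm_num, Real.exp_add]
            nlinarith [Real.exp_pos 1]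
    have h2 : (lam ^ D)⁻¹ ≤ (1 / 2) ^ X := by
      have h3 : (lam⁻¹) ^ q ≤ 1 / 2 := by
        have h4 : lam⁻¹ = 1 - 1 / q := by rw [hlam]; field_simp
        rw [h4]
        refine (Real.one_sub_div_pow_le_exp_neg (by linarith)).trans ?_
        rw [Real.exp_neg, one_div]
        gcongr
        have := Real.add_one_le_exp 1
        linarith
      rw [← inv_pow]
      calc lam⁻¹ ^ D ≤ lam⁻¹ ^ (q * X) :=
            pow_le_pow_of_le_one (by positivity) (inv_le_one_of_one_le₀ hlam1) hD
        _ = (lam⁻¹ ^ q) ^ X := pow_mul _ _ _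
        _ ≤ (1 / 2) ^ X := by gcongr
    gcongr
  · rintro y ⟨h1, h2⟩
    have hle : ∀ w ∈ B, g (y w) = if sampleLevel q k (y w) = i then lam else 1 := fun w hw => by
      simp only [hg]
      rw [if_neg (not_lt.2 (h1 w hw))]
    rw [Finset.prod_congr rfl hle, Finset.prod_ite, Finset.prod_const, Finset.prod_const_one,
      mul_one]
    exact pow_le_pow_right₀ hlam1 h2

end LevelProbability

/-! ### Success probability of the cluster algorithm -/

section Success

variable {n q k s M T D X : ℕ}

/-- The random data of a vertex: a number that determines its level, and its candidate colors. -/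
abbrev ClusterCoin (q k s M T : ℕ) : Type := Fin (q ^ k) × (Fin T → Fin s → Fin M)

/-- If a center has more than `D` conflicts, then all vertices in a certain ball have at most its
level, and many of them have exactly its level. -/
theorem exists_ball_of_conflicts (G : SimpleGraph (Fin n)) (lev : Fin n → Fin k) {a : Fin n}
    (ha : clusterCenter G (fun u => levelRadius (lev u)) a = a)
    (hD : D < ((conflictGraph G fun u => levelRadius (lev u)).neighborSet a).ncard)
    (B : Fin k → Finset (Fin n))
    (hB : ∀ i w, w ∈ B i ↔ G.edist a w ≤ (2 * levelRadius i + 1 : ℕ)) :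
    (∀ w ∈ B (lev a), lev w ≤ lev a) ∧
      D ≤ ((B (lev a)).filter fun w => lev w = lev a).card := by
  constructor
  · intro w hw
    rw [hB] at hw
    have h := radius_le_of_clusterCenter_eq ha hw
    by_contra! hlt
    have h1 : levelRadius ((lev a : ℕ) + 1) ≤ levelRadius (lev w) :=
      levelRadius_strictMono.monotone hlt
    have h2 := Nat.one_le_pow (lev a) 3 (by norm_num)
    simp only [levelRadius, pow_succ] at h h1
    omega
  · refine hD.le.trans ?_
    rw [← Set.ncard_coe_finset]
    refine Set.ncard_le_ncard (fun w hw => ?_) (Finset.finite_toSet _)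
    obtain ⟨-, h2, h3⟩ := hw
    simp only [Finset.coe_filter, Set.mem_ofPred_eq, hB]
    exact ⟨h3, Fin.ext (levelRadius_strictMono.injective h2.symm)⟩

/-- The output is wrong only if, for some vertex and some level, the ball around the vertex is
crowded with vertices of this level, or if some vertex with at most `D` conflicts remains uncolored. -/
theorem uniformProb_not_isClusterOutput_le [NeZero k] (hq : 2 ≤ q) (hn : n ≤ q ^ k) (hD : q * X ≤ D)
    (G : SimpleGraph (Fin n)) :
    uniformProb (fun ω : Fin n → ClusterCoin q k s M T =>
      ¬ IsClusterOutput G (2 * (3 ^ (k - 1) - 1)) (k * (s * M))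
        (clusterOutput (fun x => sampleLevel q k x.1) (fun x => x.2) G ω)) ≤
      n * (k * (8 * (1 / 2) ^ X)) + n * (((D : ℝ) / M) ^ s) ^ T := by
  classical
  let H : (Fin n → Fin (q ^ k)) → SimpleGraph (Fin n) := fun y =>
    conflictGraph G fun u => levelRadius (sampleLevel q k (y u))
  let B : Fin n → Fin k → Finset (Fin n) := fun a i =>
    Finset.univ.filter fun w => G.edist a w ≤ (2 * levelRadius i + 1 : ℕ)
  let crowded : Fin n → Fin k → (Fin n → Fin (q ^ k)) → Prop := fun a i y =>
    (∀ w ∈ B a i, sampleLevel q k (y w) ≤ i) ∧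
      D ≤ ((B a i).filter fun w => sampleLevel q k (y w) = i).card
  let stuck : Fin n → (Fin n → Fin (q ^ k)) → (Fin T → Fin n → Fin s → Fin M) → Prop :=
    fun a y x => ((H y).neighborSet a).ncard ≤ D ∧ colorTrials (H y) T x a = none
  let e : (Fin n → ClusterCoin q k s M T) ≃
      (Fin n → Fin (q ^ k)) × (Fin T → Fin n → Fin s → Fin M) :=
    (Equiv.arrowProdEquivProdArrow _ _ _).trans
      (Equiv.prodCongr (Equiv.refl _) (Equiv.piComm _))
  have hsub : ∀ ω : Fin n → ClusterCoin q k s M T,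
      ¬ IsClusterOutput G (2 * (3 ^ (k - 1) - 1)) (k * (s * M))
        (clusterOutput (fun x => sampleLevel q k x.1) (fun x => x.2) G ω) →
      (∃ a i, crowded a i (e ω).1) ∨ ∃ a, stuck a (e ω).1 (e ω).2 := by
    intro ω hω
    obtain ⟨a, ha, hcol⟩ : ∃ a,
        clusterCenter G (fun u => levelRadius (sampleLevel q k (ω u).1)) a = a ∧
        colorTrials (conflictGraph G fun u => levelRadius (sampleLevel q k (ω u).1)) T
          (fun t u => (ω u).2 t) a = none := by
      by_contra! hne
      exact hω (isClusterOutput_clusterOutput _ _ G ω hne)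
    by_cases hdeg : ((H (e ω).1).neighborSet a).ncard ≤ D
    · exact Or.inr ⟨a, hdeg, hcol⟩
    · exact Or.inl ⟨a, _, exists_ball_of_conflicts G (fun u => sampleLevel q k (ω u).1) ha
        (not_le.1 hdeg) (B a) fun i w => by simp [B]⟩
  refine (uniformProb_mono hsub).trans ((uniformProb_or_le _ _).trans (add_le_add ?_ ?_))
  · refine (uniformProb_exists_le _ (ε := k * (8 * (1 / 2) ^ X)) fun a => ?_).trans_eq (by simp)
    refine (uniformProb_exists_le _ (ε := 8 * (1 / 2) ^ X) fun i => ?_).trans_eq (by simp)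
    rw [uniformProb_congr e fun x => crowded a i x.1]
    refine (uniformProb_prod_le (fun y _ => crowded a i y) (crowded a i) (ε := 1)
      (fun _ _ h => h) fun y _ => uniformProb_le_one _).trans ?_
    rw [one_mul]
    exact uniformProb_no_higher_level_le hq (by simpa using hn) (B a i) i hD
  · refine (uniformProb_exists_le _ (ε := (((D : ℝ) / M) ^ s) ^ T) fun a => ?_).trans_eq (by simp)
    rw [uniformProb_congr e fun x => stuck a x.1 x.2]
    refine (uniformProb_prod_le (stuck a) (fun y => ((H y).neighborSet a).ncard ≤ D)
      (fun _ _ h => h.1) fun y hy => ?_).trans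
      (mul_le_of_le_one_right (by positivity) (uniformProb_le_one _))
    exact (uniformProb_mono fun _ h => h.2).trans (uniformProb_colorTrials_le hy)

end Success

/-! ### Local rules and distributed algorithms -/

section Rules

/-- Distinct identity numbers from `{1, …, n}` identify the vertices with `Fin n`. -/
theorem exists_equiv_fin {V : Type u} [Fintype V] {ident : V → ℕ}
    (hinj : Function.Injective ident) (hrange : ∀ v, 1 ≤ ident v ∧ ident v ≤ Fintype.card V) :
    ∃ e : V ≃ Fin (Fintype.card V), ∀ v, (e v : ℕ) + 1 = ident v := by
  let f : V → Fin (Fintype.card V) := fun v => ⟨ident v - 1, by have := hrange v; omega⟩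
  have hf : Function.Injective f := fun u v huv => hinj (by
    have h : ident u - 1 = ident v - 1 := congrArg Fin.val huv
    have := hrange u
    have := hrange v
    omega)
  refine ⟨Equiv.ofBijective f ((Fintype.bijective_iff_injective_and_card f).2 ⟨hf, by simp⟩),
    fun v => ?_⟩
  have := hrange v
  simp only [Equiv.ofBijective_apply, f]
  omega

/-- It suffices to bound the failure probability of a local rule on networks with vertices
`Fin n`. -/
theorem computesDecomposition_gatherAlgorithm {V : Type u} [Fintype V] (G : SimpleGraph V)
    (R : ∀ n, LocalRule n (ℕ × ℕ)) {c d d' N : ℕ} {ℓ τ : ℝ} (hd : d' ≤ d) (hℓ : (N : ℝ) ≤ ℓ)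
    (hτ : ((R (Fintype.card V)).radius : ℝ) ≤ τ)
    (hR : ∀ G' : SimpleGraph (Fin (Fintype.card V)),
      uniformProb (fun ω => ¬ IsClusterOutput G' d' N ((R (Fintype.card V)).rule G' ω)) ≤
        1 / (Fintype.card V : ℝ) ^ c) :
    ComputesDecomposition (gatherAlgorithm R) G c d ℓ τ := by
  intro ident hinj hrange
  obtain ⟨e, he⟩ := exists_equiv_fin hinj hrange
  have hterm := fun ω => gatherAlgorithm_terminatesWith R G ident e he ω hτ
  refine ⟨fun ω => ⟨_, hterm ω⟩, ?_⟩
  let ε : (gatherAlgorithm R).Coins V ≃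
      (Fin (Fintype.card V) → Fin (R (Fintype.card V)).bits → Bool) :=
    Equiv.arrowCongr e (Equiv.refl _)
  have h1 := hR (G.comap e.symm)
  rw [uniformProb_not, sub_le_comm, ← uniformProb_congr ε] at h1
  have : Finite ((gatherAlgorithm R).Coins V) := Finite.of_equiv _ ε.symm
  refine h1.trans (uniformProb_mono (p := fun ω => IsClusterOutput (G.comap e.symm) d' N
    ((R (Fintype.card V)).rule (G.comap e.symm) (ε ω))) fun ω hω => ⟨_, hterm ω, ?_⟩)
  exact hω.comap_equiv e |>.isLabeledDecomposition hd hℓ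

variable {n : ℕ}

/-- The random data of a vertex, encoded by fair bits. -/
noncomputable def coinEquiv (a k m s T : ℕ) :
    (Fin (a * k + m * s * T) → Bool) ≃ ClusterCoin (2 ^ a) k s (2 ^ m) T :=
  (Finite.equivFinOfCardEq (n := 2 ^ (a * k + m * s * T))
    (by rw [Nat.card_fun, Nat.card_fin, Nat.card_eq_fintype_card, Fintype.card_bool])).trans
  (Finite.equivFinOfCardEq (by
    rw [ClusterCoin, Nat.card_prod, Nat.card_fun, Nat.card_fun, Nat.card_fin, Nat.card_fin,
      Nat.card_fin, Nat.card_fin, ← pow_mul, ← pow_mul, ← pow_mul, ← pow_add,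
      mul_assoc])).symm

/-- The rule by which every vertex names its cluster after the center and labels it by the level and
the color of the center, with sampling probability `2 ^ (-a)` from level to level, and `T` trials
with `s` candidate colors each, from palettes of size `2 ^ m`. -/
noncomputable def clusterRule (n a k m s T : ℕ) [NeZero k] : LocalRule n (ℕ × ℕ) :=
  { bits := a * k + m * s * T
    radius := 3 ^ (k - 1) - 1 + T * (2 * (3 ^ (k - 1) - 1) + 1)
    rule := fun G ω => clusterOutput (S := ClusterCoin (2 ^ a) k s (2 ^ m) T)
      (fun x => sampleLevel (2 ^ a) k x.1) (fun x => x.2) G (coinEquiv a k m s T ∘ ω)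
    rule_eq := fun h => (h.comp (coinEquiv a k m s T)).clusterOutput_eq _ _ }

theorem clusterRule_radius_le (a k m s T : ℕ) [NeZero k] :
    (clusterRule n a k m s T).radius ≤ (T + 1) * 3 ^ k := by
  obtain ⟨κ, rfl⟩ := Nat.exists_eq_succ_of_ne_zero (NeZero.ne k)
  have h1 := Nat.one_le_pow κ 3 (by norm_num)
  have h2 : 2 * (3 ^ κ - 1) + 1 ≤ 3 ^ (κ + 1) := by
    rw [pow_succ]
    omega
  have h3 : 3 ^ κ - 1 ≤ 3 ^ (κ + 1) := by omega
  simp only [clusterRule, Nat.succ_eq_add_one, Nat.add_one_sub_one]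
  have := Nat.mul_le_mul_left T h2
  rw [add_mul, one_mul]
  omega

/-- The cluster rule fails with probability at most `1 / n ^ c` if the palette is `μ` times as
large as the number of conflicts of a center, and `s * T` candidate colors suffice to make the
failure probability `μ ^ (- s * T)` of the coloring small. -/
theorem uniformProb_clusterRule_le {a k m s T L μ c : ℕ} [NeZero k] (ha : 1 ≤ a) (hn : 2 ≤ n)
    (hk : k ≤ n) (hnk : n ≤ (2 ^ a) ^ k) (hL : n ≤ 2 ^ L)
    (hμ0 : 1 ≤ μ) (hm : μ * (2 ^ a * (L * (c + 6))) ≤ 2 ^ m) (hμ : n ^ (c + 2) ≤ μ ^ (s * T))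
    (G : SimpleGraph (Fin n)) :
    uniformProb (fun ω => ¬ IsClusterOutput G (2 * (3 ^ (k - 1) - 1)) (k * (s * 2 ^ m))
      ((clusterRule n a k m s T).rule G ω)) ≤ 1 / (n : ℝ) ^ c := by
  have hn' : (2 : ℝ) ≤ n := by exact_mod_cast hn
  have hn0 : (0 : ℝ) < n := by linarith
  have hq : 2 ≤ 2 ^ a := by simpa using Nat.pow_le_pow_right (n := 2) (by norm_num) ha
  set X := L * (c + 6)
  set D := 2 ^ a * X
  have hL0 : L ≠ 0 := by
    rintro rfl
    simp at hL
    omega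
  have hD0 : (0 : ℝ) < D := by
    have : 0 < D := by positivity
    exact_mod_cast this
  have h := uniformProb_not_isClusterOutput_le (s := s) (M := 2 ^ m) (T := T) hq hnk
    (le_refl D) G
  rw [← uniformProb_congr (Equiv.arrowCongr (Equiv.refl _) (coinEquiv a k m s T))] at h
  refine h.trans ?_
  -- Each of the two sources of failure contributes at most half of `1 / n ^ c`.
  have h1 : (n : ℝ) * (k * (8 * (1 / 2) ^ X)) ≤ 1 / 2 * (1 / (n : ℝ) ^ c) := by
    have hX : ((1 : ℝ) / 2) ^ X ≤ 1 / (n : ℝ) ^ (c + 6) := by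
      rw [div_pow, one_pow]
      gcongr
      rw [pow_mul]
      gcongr
      exact_mod_cast hL
    calc (n : ℝ) * (k * (8 * (1 / 2) ^ X)) ≤ n * (n * (8 * (1 / (n : ℝ) ^ (c + 6)))) := by gcongr
      _ = 8 / n ^ 4 * (1 / (n : ℝ) ^ c) := by
        field_simp
        ring
      _ ≤ 1 / 2 * (1 / (n : ℝ) ^ c) := by
        gcongr ?_ * _
        rw [div_le_div_iff₀ (by positivity) (by norm_num)]
        calc (8 : ℝ) * 2 = 1 * 2 ^ 4 := by norm_num
          _ ≤ 1 * (n : ℝ) ^ 4 := by gcongr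
  have h2 : (n : ℝ) * (((D : ℝ) / (2 ^ m : ℕ)) ^ s) ^ T ≤ 1 / 2 * (1 / (n : ℝ) ^ c) := by
    have hDM : (D : ℝ) / (2 ^ m : ℕ) ≤ 1 / μ := by
      rw [div_le_div_iff₀ (by positivity) (by positivity), one_mul, mul_comm]
      exact_mod_cast hm
    calc (n : ℝ) * (((D : ℝ) / (2 ^ m : ℕ)) ^ s) ^ T ≤ n * ((1 / (μ : ℝ)) ^ s) ^ T := by gcongr
      _ = n * (1 / (μ : ℝ) ^ (s * T)) := by rw [← pow_mul, div_pow, one_pow]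
      _ ≤ n * (1 / (n : ℝ) ^ (c + 2)) := by
        gcongr
        exact_mod_cast hμ
      _ = 1 / n * (1 / (n : ℝ) ^ c) := by
        field_simp
        ring
      _ ≤ 1 / 2 * (1 / (n : ℝ) ^ c) := by gcongr
  linarith

/-- The rule by which every vertex names its connected component after the smallest vertex. -/
noncomputable def componentRule (n : ℕ) : LocalRule n (ℕ × ℕ) where
  bits := 0
  radius := n
  rule G _ v := (sInf {i | ∃ u : Fin n, (u : ℕ) = i ∧ G.Reachable v u}, 1)
  rule_eq {G G' ω ω' v} h := by
    have key : ∀ {G G' : SimpleGraph (Fin n)} {ω ω' : Fin n → Fin 0 → Bool},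
        Agree G G' ω ω' n v → ∀ u, G.Reachable v u → G'.Reachable v u := by
      rintro G G' ω ω' h u ⟨p⟩
      have hlen := (p.toPath.2.length_lt).le
      rw [Fintype.card_fin] at hlen
      exact (Agree.of_walk (t := 0) _ hlen h).2.choose.reachable
    have : ∀ u, G.Reachable v u ↔ G'.Reachable v u := fun u => ⟨key h u, key h.symm u⟩
    simp only [this]

theorem isClusterOutput_componentRule (G : SimpleGraph (Fin n))
    (ω : Fin n → Fin (componentRule n).bits → Bool) :
    IsClusterOutput G n 1 ((componentRule n).rule G ω) := by
  have hname : ∀ u v, G.Reachable u v →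
      ((componentRule n).rule G ω u).1 = ((componentRule n).rule G ω v).1 := by
    intro u v huv
    have : ∀ w, G.Reachable u w ↔ G.Reachable v w :=
      fun w => ⟨huv.symm.trans, huv.trans⟩
    simp only [componentRule, this]
  have hreach : ∀ u v, ((componentRule n).rule G ω u).1 = ((componentRule n).rule G ω v).1 →
      G.Reachable u v := by
    intro u v huv
    have hmem : ∀ w, ∃ x : Fin n, (x : ℕ) = ((componentRule n).rule G ω w).1 ∧ G.Reachable w x :=
      fun w => Nat.sInf_mem (s := {i | ∃ x : Fin n, (x : ℕ) = i ∧ G.Reachable w x})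
        ⟨w, w, rfl, Reachable.refl w⟩
    obtain ⟨x, hx, hux⟩ := hmem u
    obtain ⟨y, hy, hvy⟩ := hmem v
    obtain rfl : x = y := Fin.ext (hx.trans (huv.trans hy.symm))
    exact hux.trans hvy.symm
  refine ⟨fun u v huv => ?_, fun _ _ _ => rfl,
    fun u v huv hne => absurd (hname _ _ huv.reachable) hne, fun _ => le_rfl, fun _ => le_rfl⟩
  obtain ⟨p⟩ := hreach u v huv
  have hlen := (p.toPath.2.length_lt).le
  rw [Fintype.card_fin] at hlen
  exact ⟨p.toPath, hlen, fun w hw => (hname _ _ ⟨p.toPath.1.takeUntil w hw⟩).symm⟩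

end Rules

/-! ### Choice of the parameters -/

section Parameters

/-- The sampling probability from level to level is `2 ^ (-levelBits n k)`, so that `k` levels
suffice for `n` vertices. -/
noncomputable def levelBits (n k : ℕ) : ℕ := ⌈Real.logb 2 n / k⌉₊

variable {n k : ℕ}

theorem two_le_of_le_logb (hk : 1 ≤ k) (hkn : (k : ℝ) ≤ Real.logb 2 n) : 2 ≤ n := by
  by_contra! h
  have hk' : (1 : ℝ) ≤ k := by exact_mod_cast hk
  have : n = 0 ∨ n = 1 := by omega
  rcases this with rfl | rfl <;> simp at hkn <;> linarith

theorem two_rpow_logb (hn : 2 ≤ n) : (2 : ℝ) ^ Real.logb 2 n = n :=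
  Real.rpow_logb (by norm_num) (by norm_num) (by exact_mod_cast (by omega : 0 < n))

theorem le_of_le_logb (hn : 2 ≤ n) (hkn : (k : ℝ) ≤ Real.logb 2 n) : k ≤ n := by
  have h : ((2 ^ k : ℕ) : ℝ) ≤ n := by
    rw [← two_rpow_logb hn]
    push_cast
    rw [← Real.rpow_natCast]
    exact Real.rpow_le_rpow_of_exponent_le (by norm_num) hkn
  exact Nat.lt_two_pow_self.le.trans (by exact_mod_cast h)

theorem one_le_levelBits (hk : 1 ≤ k) (hkn : (k : ℝ) ≤ Real.logb 2 n) : 1 ≤ levelBits n k := by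
  have hk' : (0 : ℝ) < k := by exact_mod_cast hk
  exact Nat.ceil_pos.2 (div_pos (hk'.trans_le hkn) hk')

theorem le_two_pow_levelBits_pow (hn : 2 ≤ n) (hk : 1 ≤ k) : n ≤ (2 ^ levelBits n k) ^ k := by
  have hk' : (0 : ℝ) < k := by exact_mod_cast hk
  have h : (n : ℝ) ≤ ((2 ^ levelBits n k) ^ k : ℕ) := by
    rw [← pow_mul]
    nth_rewrite 1 [← two_rpow_logb hn]
    push_cast
    rw [← Real.rpow_natCast]
    refine Real.rpow_le_rpow_of_exponent_le (by norm_num) ?_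
    push_cast
    exact (div_le_iff₀ hk').1 (Nat.le_ceil _)
  exact_mod_cast h

theorem two_pow_levelBits_le (hn : 2 ≤ n) (hkn : (k : ℝ) ≤ Real.logb 2 n) :
    (2 : ℝ) ^ levelBits n k ≤ 2 * (n : ℝ) ^ (1 / (k : ℝ)) := by
  have h0 : 0 ≤ Real.logb 2 n / k :=
    div_nonneg ((Nat.cast_nonneg k).trans hkn) (Nat.cast_nonneg k)
  have h1 := (Nat.ceil_lt_add_one h0).le
  calc (2 : ℝ) ^ levelBits n k = (2 : ℝ) ^ (levelBits n k : ℝ) := (Real.rpow_natCast _ _).symm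
    _ ≤ (2 : ℝ) ^ (Real.logb 2 n / k + 1) := Real.rpow_le_rpow_of_exponent_le (by norm_num) h1
    _ = 2 * (n : ℝ) ^ (1 / (k : ℝ)) := by
      nth_rewrite 2 [← two_rpow_logb hn]
      rw [Real.rpow_add_one (by norm_num), ← Real.rpow_mul (by norm_num), mul_comm, mul_one_div]

theorem one_le_logb (hn : 2 ≤ n) : 1 ≤ Real.logb 2 n := by
  rw [Real.le_logb_iff_rpow_le (by norm_num) (by exact_mod_cast (by omega : 0 < n)), Real.rpow_one]
  exact_mod_cast hn

theorem clog_le_two_mul_logb (hn : 2 ≤ n) : (Nat.clog 2 n : ℝ) ≤ 2 * Real.logb 2 n := by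
  have h1 := one_le_logb hn
  have h : 2 ^ (Nat.clog 2 n - 1) < n := Nat.pow_pred_clog_lt_self (by norm_num) hn
  have h2 : ((Nat.clog 2 n - 1 : ℕ) : ℝ) ≤ Real.logb 2 n := by
    rw [Real.le_logb_iff_rpow_le (by norm_num) (by exact_mod_cast (by omega : 0 < n)),
      Real.rpow_natCast]
    exact_mod_cast h.le
  have h3 : (Nat.clog 2 n : ℝ) ≤ ((Nat.clog 2 n - 1 : ℕ) : ℝ) + 1 := by
    exact_mod_cast (by omega : Nat.clog 2 n ≤ Nat.clog 2 n - 1 + 1)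
  linarith

theorem two_pow_clog_le {y : ℕ} (hy : 2 ≤ y) : 2 ^ Nat.clog 2 y ≤ 2 * y := by
  have h : 2 ^ (Nat.clog 2 y - 1) < y := Nat.pow_pred_clog_lt_self (by norm_num) hy
  have h0 : 0 < Nat.clog 2 y := Nat.clog_pos (by norm_num) hy
  obtain ⟨m, hm⟩ := Nat.exists_eq_succ_of_ne_zero h0.ne'
  rw [hm] at h ⊢
  simp only [Nat.succ_eq_add_one, Nat.add_one_sub_one] at h
  rw [pow_succ]
  omega

/-- As some iterate of the logarithm is at most `1`, the infimum that defines `logStar` is not the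
junk value of an empty set. -/
theorem one_le_logStar {x : ℝ} (hx : 1 < x) : 1 ≤ logStar x := by
  have hex : ∀ m : ℕ, ∀ y : ℝ, y ≤ m + 1 → ∃ i, (Real.logb 2)^[i] y ≤ 1 := by
    intro m
    induction m with
    | zero => exact fun y hy => ⟨0, by simpa using hy⟩
    | succ m ih =>
      intro y hy
      by_cases h1 : y ≤ 2
      · by_cases h0 : y ≤ 1
        · exact ⟨0, h0⟩
        · refine ⟨1, ?_⟩
          rw [Function.iterate_one, Real.logb_le_iff_le_rpow (by norm_num) (by linarith)]
          simpa using h1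
      · -- The tangent line of the logarithm at `2` gives `logb 2 y ≤ y - 1`.
        have hle : Real.logb 2 y ≤ m + 1 := by
          have h2 : Real.log (y / 2) ≤ y / 2 - 1 := Real.log_le_sub_one_of_pos (by linarith)
          rw [Real.log_div (by linarith) (by norm_num)] at h2
          have h3 := Real.log_two_gt_d9
          rw [Real.logb, div_le_iff₀ (by linarith)]
          push_cast at hy
          nlinarith
        obtain ⟨i, hi⟩ := ih (Real.logb 2 y) hle
        exact ⟨i + 1, hi⟩
  obtain ⟨i, hi⟩ := hex ⌈x⌉₊ x (by have := Nat.le_ceil x; linarith)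
  have hne : logStar x ≠ 0 := by
    intro h
    have hmem := Nat.sInf_mem (s := {i : ℕ | (Real.logb 2)^[i] x ≤ 1}) ⟨i, hi⟩
    rw [← logStar, h] at hmem
    have : x ≤ 1 := hmem
    linarith
  omega

end Parameters

/-! ### Quality and running time -/

section Computes

/-- The rule with a single trial, in which every vertex has `O(log n)` candidate colors. -/
noncomputable def singleTrialRule (c κ n : ℕ) : LocalRule n (ℕ × ℕ) :=
  let a := levelBits n (κ + 1)
  let L := Nat.clog 2 n
  clusterRule n a (κ + 1) (Nat.clog 2 (2 * (2 ^ a * (L * (c + 6))))) (L * (c + 2)) 1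

/-- The rule with `O(k)` trials, in each of which every vertex has a single candidate color. -/
noncomputable def manyTrialsRule (c κ n : ℕ) : LocalRule n (ℕ × ℕ) :=
  let a := levelBits n (κ + 1)
  let L := Nat.clog 2 n
  clusterRule n a (κ + 1) (Nat.clog 2 (2 ^ a * (2 ^ a * (L * (c + 6))))) 1 ((κ + 1) * (c + 2))

variable {V : Type u} [Fintype V]

theorem two_mul_radius_le (κ : ℕ) : 2 * (3 ^ (κ + 1 - 1) - 1) ≤ 3 ^ (κ + 1) := by
  have h1 := Nat.one_le_pow κ 3 (by norm_num)
  rw [Nat.add_one_sub_one, pow_succ]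
  omega

theorem rpow_one_div_sq {x : ℝ} (hx : 0 ≤ x) (k : ℝ) : (x ^ (1 / k)) ^ 2 = x ^ (2 / k) := by
  rw [← Real.rpow_natCast, ← Real.rpow_mul hx]
  congr 1
  push_cast
  ring

theorem computesDecomposition_singleTrialRule (G : SimpleGraph V) (c κ : ℕ)
    (hk : ((κ + 1 : ℕ) : ℝ) ≤ Real.logb 2 (Fintype.card V)) {τ : ℝ}
    (hτ : 2 * (3 : ℝ) ^ (κ + 1) ≤ τ) :
    ComputesDecomposition (gatherAlgorithm (singleTrialRule c κ)) G c (3 ^ (κ + 1))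
      (32 * (c + 2) * (c + 6) * (((κ + 1 : ℕ) : ℝ) *
        (Fintype.card V : ℝ) ^ (2 / ((κ + 1 : ℕ) : ℝ)) * Real.logb 2 (Fintype.card V) ^ 2)) τ := by
  set n := Fintype.card V with hn_def
  have hn := two_le_of_le_logb (Nat.succ_le_succ (Nat.zero_le κ)) hk
  set a := levelBits n (κ + 1) with ha
  set L := Nat.clog 2 n with hL
  have ha1 : 1 ≤ a := one_le_levelBits (Nat.succ_le_succ (Nat.zero_le κ)) hk
  have hL1 : 1 ≤ L := Nat.clog_pos (by norm_num) hn
  set y := 2 * (2 ^ a * (L * (c + 6))) with hy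
  have hy2 : 2 ≤ y := by
    have : 0 < 2 ^ a * (L * (c + 6)) := by positivity
    omega
  have hnL : n ≤ 2 ^ L := Nat.le_pow_clog (by norm_num) n
  refine computesDecomposition_gatherAlgorithm G _ (two_mul_radius_le κ)
    (N := (κ + 1) * (L * (c + 2) * 2 ^ Nat.clog 2 y)) ?_ (le_trans ?_ hτ) ?_
  · have h1 : ((2 ^ Nat.clog 2 y : ℕ) : ℝ) ≤ (2 * y : ℕ) := by exact_mod_cast two_pow_clog_le hy2
    have h2 := clog_le_two_mul_logb hn
    have h3 := two_pow_levelBits_le hn hk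
    have hn1 : (1 : ℝ) ≤ n := by exact_mod_cast (by omega : 1 ≤ n)
    have h4 : (n : ℝ) ^ (1 / ((κ + 1 : ℕ) : ℝ)) ≤ (n : ℝ) ^ (2 / ((κ + 1 : ℕ) : ℝ)) := by
      refine Real.rpow_le_rpow_of_exponent_le hn1 ?_
      gcongr
      norm_num
    rw [← hL] at h2
    rw [← ha] at h3
    have hlog := one_le_logb hn
    calc (((κ + 1) * (L * (c + 2) * 2 ^ Nat.clog 2 y) : ℕ) : ℝ)
        = ((κ + 1 : ℕ) : ℝ) * (L * (c + 2) * (2 ^ Nat.clog 2 y : ℕ)) := by push_cast; ring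
      _ ≤ ((κ + 1 : ℕ) : ℝ) * (L * (c + 2) * (2 * y : ℕ)) := by gcongr
      _ = 4 * (c + 2) * (c + 6) * (((κ + 1 : ℕ) : ℝ) * (2 : ℝ) ^ a * (L : ℝ) ^ 2) := by
        rw [hy]; push_cast; ring
      _ ≤ 4 * (c + 2) * (c + 6) * (((κ + 1 : ℕ) : ℝ) *
          (2 * (n : ℝ) ^ (2 / ((κ + 1 : ℕ) : ℝ))) * (2 * Real.logb 2 n) ^ 2) := by
        have h5 := h3.trans (mul_le_mul_of_nonneg_left h4 zero_le_two)
        gcongr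
      _ = _ := by ring
  · have h := clusterRule_radius_le (n := n) a (κ + 1) (Nat.clog 2 y) (L * (c + 2)) 1
    exact_mod_cast h
  · exact uniformProb_clusterRule_le (μ := 2) ha1 hn (le_of_le_logb hn hk)
      (le_two_pow_levelBits_pow hn (Nat.succ_le_succ (Nat.zero_le κ))) hnL (by norm_num)
      (Nat.le_pow_clog (by norm_num) y) (by
        rw [mul_one, pow_mul]
        exact Nat.pow_le_pow_left hnL _)

theorem computesDecomposition_manyTrialsRule (G : SimpleGraph V) (c κ : ℕ)
    (R : ∀ n, LocalRule n (ℕ × ℕ))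
    (hR : R (Fintype.card V) = manyTrialsRule c κ (Fintype.card V))
    (hk : ((κ + 1 : ℕ) : ℝ) ≤ Real.logb 2 (Fintype.card V)) {d : ℕ} {ℓ τ : ℝ}
    (hd : 3 ^ (κ + 1) ≤ d)
    (hℓ : 16 * (c + 6) * (((κ + 1 : ℕ) : ℝ) *
        (Fintype.card V : ℝ) ^ (2 / ((κ + 1 : ℕ) : ℝ)) * Real.logb 2 (Fintype.card V)) ≤ ℓ)
    (hτ : (c + 3) * (((κ + 1 : ℕ) : ℝ) * (3 : ℝ) ^ (κ + 1)) ≤ τ) :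
    ComputesDecomposition (gatherAlgorithm R) G c d ℓ τ := by
  set n := Fintype.card V with hn_def
  have hn := two_le_of_le_logb (Nat.succ_le_succ (Nat.zero_le κ)) hk
  set a := levelBits n (κ + 1) with ha
  set L := Nat.clog 2 n with hL
  have ha1 : 1 ≤ a := one_le_levelBits (Nat.succ_le_succ (Nat.zero_le κ)) hk
  have hL1 : 1 ≤ L := Nat.clog_pos (by norm_num) hn
  set y := 2 ^ a * (2 ^ a * (L * (c + 6))) with hy
  have hy2 : 2 ≤ y := by
    have h0 : 0 < 2 ^ a * (L * (c + 6)) := by positivity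
    have h2 : 2 ^ 1 ≤ 2 ^ a := Nat.pow_le_pow_right (by norm_num) ha1
    nlinarith
  have hnL : n ≤ 2 ^ L := Nat.le_pow_clog (by norm_num) n
  refine computesDecomposition_gatherAlgorithm G _ ((two_mul_radius_le κ).trans hd)
    (N := (κ + 1) * (1 * 2 ^ Nat.clog 2 y)) (le_trans ?_ hℓ) (le_trans ?_ hτ) ?_
  · have h1 : ((2 ^ Nat.clog 2 y : ℕ) : ℝ) ≤ (2 * y : ℕ) := by exact_mod_cast two_pow_clog_le hy2
    have h2 := clog_le_two_mul_logb hn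
    have h3 := two_pow_levelBits_le hn hk
    rw [← hL] at h2
    rw [← ha] at h3
    calc (((κ + 1) * (1 * 2 ^ Nat.clog 2 y) : ℕ) : ℝ)
        = ((κ + 1 : ℕ) : ℝ) * (2 ^ Nat.clog 2 y : ℕ) := by push_cast; ring
      _ ≤ ((κ + 1 : ℕ) : ℝ) * (2 * y : ℕ) := by gcongr
      _ = 2 * (c + 6) * (((κ + 1 : ℕ) : ℝ) * ((2 : ℝ) ^ a) ^ 2 * (L : ℝ)) := by
        rw [hy]; push_cast; ring
      _ ≤ 2 * (c + 6) * (((κ + 1 : ℕ) : ℝ) *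
          (2 * (n : ℝ) ^ (1 / ((κ + 1 : ℕ) : ℝ))) ^ 2 * (2 * Real.logb 2 n)) := by
        gcongr
      _ = _ := by
        rw [mul_pow, rpow_one_div_sq (Nat.cast_nonneg n)]
        ring
  · rw [hR]
    have h := clusterRule_radius_le (n := n) a (κ + 1) (Nat.clog 2 y) 1 ((κ + 1) * (c + 2))
    have h' : ((κ + 1) * (c + 2) + 1) * 3 ^ (κ + 1) ≤ (c + 3) * ((κ + 1) * 3 ^ (κ + 1)) := by
      rw [← mul_assoc]
      exact Nat.mul_le_mul_right _ (by nlinarith)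
    exact_mod_cast h.trans h'
  · rw [hR]
    exact uniformProb_clusterRule_le (μ := 2 ^ a) ha1 hn (le_of_le_logb hn hk)
      (le_two_pow_levelBits_pow hn (Nat.succ_le_succ (Nat.zero_le κ))) hnL Nat.one_le_two_pow
      (Nat.le_pow_clog (by norm_num) y) (by
        rw [one_mul, pow_mul]
        exact Nat.pow_le_pow_left
          (le_two_pow_levelBits_pow hn (Nat.succ_le_succ (Nat.zero_le κ))) _)

theorem computesDecomposition_componentRule (G : SimpleGraph V) (c : ℕ)
    (R : ∀ n, LocalRule n (ℕ × ℕ)) (hR : R (Fintype.card V) = componentRule (Fintype.card V))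
    {d : ℕ} {ℓ τ : ℝ} (hd : Fintype.card V ≤ d) (hℓ : 1 ≤ ℓ) (hτ : (Fintype.card V : ℝ) ≤ τ) :
    ComputesDecomposition (gatherAlgorithm R) G c d ℓ τ := by
  refine computesDecomposition_gatherAlgorithm G R hd (N := 1) (by simpa using hℓ) ?_ fun G' => ?_
  · rw [hR]
    exact hτ
  · rw [hR]
    have : ∀ ω, (¬ IsClusterOutput G' (Fintype.card V) 1
        ((componentRule (Fintype.card V)).rule G' ω)) ↔ False :=
      fun ω => by simp [isClusterOutput_componentRule]
    simp only [this]
    simp [uniformProb]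

/-- For large `n`, polylogarithmic factors are smaller than the power of `n` that is left if
`4 / k ≤ δ`. -/
theorem eventually_colors_le {δ : ℝ} (hδ : 0 < δ) (C k : ℝ) (hk : 2 / k ≤ δ / 2) :
    ∀ᶠ n : ℕ in Filter.atTop, k ≤ Real.logb 2 n ∧
      C * (k * (n : ℝ) ^ (2 / k) * Real.logb 2 n) ≤ (n : ℝ) ^ δ := by
  have hlog : Filter.Tendsto (fun n : ℕ => Real.logb 2 n) Filter.atTop Filter.atTop :=
    (Real.tendsto_logb_atTop (by norm_num)).comp tendsto_natCast_atTop_atTop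
  have ho := ((isLittleO_log_rpow_atTop (half_pos hδ)).const_mul_left
    (|C * k| / Real.log 2)).comp_tendsto tendsto_natCast_atTop_atTop
  filter_upwards [hlog.eventually_ge_atTop k, ho.bound one_pos, Filter.eventually_ge_atTop 2]
    with n h1 h2 h3
  refine ⟨h1, ?_⟩
  have hn1 : (1 : ℝ) ≤ n := by exact_mod_cast (by omega : 1 ≤ n)
  have hn0 : (0 : ℝ) < n := by linarith
  simp only [Function.comp_apply, one_mul] at h2
  have h4 : |C * k| * Real.logb 2 n ≤ (n : ℝ) ^ (δ / 2) := by
    have := (le_abs_self _).trans h2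
    rw [Real.norm_of_nonneg (by positivity)] at this
    rwa [Real.logb, ← mul_div_assoc, ← div_mul_eq_mul_div]
  have h5 : (n : ℝ) ^ (2 / k) ≤ (n : ℝ) ^ (δ / 2) :=
    Real.rpow_le_rpow_of_exponent_le hn1 hk
  have hlog0 : 0 ≤ Real.logb 2 n := zero_le_one.trans (one_le_logb h3)
  calc C * (k * (n : ℝ) ^ (2 / k) * Real.logb 2 n)
      = (C * k) * Real.logb 2 n * (n : ℝ) ^ (2 / k) := by ring
    _ ≤ |C * k| * Real.logb 2 n * (n : ℝ) ^ (2 / k) := by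
      gcongr
      exact le_abs_self _
    _ ≤ (n : ℝ) ^ (δ / 2) * (n : ℝ) ^ (δ / 2) := by gcongr
    _ = (n : ℝ) ^ δ := by rw [← Real.rpow_add hn0, add_halves]

end Computes

theorem mainTheorem1 :
    (∀ (δ : ℝ), 0 < δ → ∀ c : ℕ,
      ∃ (d T : ℕ) (A : DistributedAlgorithm (ℕ × ℕ)),
        ∀ (V : Type u) [Fintype V] [Nonempty V] (G : SimpleGraph V),
          ComputesDecomposition A G c d ((Fintype.card V : ℝ) ^ δ) (T : ℝ)) ∧
    (∀ c : ℕ, ∃ (K : ℝ) (A : ℕ → DistributedAlgorithm (ℕ × ℕ)),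
      ∀ (V : Type u) [Fintype V] [Nonempty V] (G : SimpleGraph V) (k : ℕ),
        1 ≤ k → (k : ℝ) ≤ Real.logb 2 (Fintype.card V : ℝ) →
          ComputesDecomposition (A k) G c (3 ^ k)
            (K * ((k : ℝ) * (Fintype.card V : ℝ) ^ (2 / (k : ℝ)) *
              Real.logb 2 (Fintype.card V : ℝ) ^ 2))
            (K * ((3 : ℝ) ^ k * (logStar (Fintype.card V : ℝ) : ℝ)))) ∧
    (∀ c : ℕ, ∃ (K : ℝ) (A : ℕ → DistributedAlgorithm (ℕ × ℕ)),
      ∀ (V : Type u) [Fintype V] [Nonempty V] (G : SimpleGraph V) (k : ℕ),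
        1 ≤ k → (k : ℝ) ≤ Real.logb 2 (Fintype.card V : ℝ) →
          ComputesDecomposition (A k) G c (3 ^ k)
            (K * ((k : ℝ) * (Fintype.card V : ℝ) ^ (2 / (k : ℝ)) *
              Real.logb 2 (Fintype.card V : ℝ)))
            (K * ((k : ℝ) * (3 : ℝ) ^ k))) := by
  refine ⟨fun δ hδ c => ?_, fun c => ?_, fun c => ?_⟩
  · obtain ⟨κ, hκ⟩ := exists_nat_ge (4 / δ)
    have hk : 2 / ((κ + 1 : ℕ) : ℝ) ≤ δ / 2 := by
      rw [div_le_iff₀ hδ] at hκ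
      rw [div_le_div_iff₀ (by positivity) (by norm_num)]
      push_cast
      nlinarith
    obtain ⟨n₀, hn₀⟩ := Filter.eventually_atTop.1
      (eventually_colors_le hδ (16 * (c + 6)) ((κ + 1 : ℕ) : ℝ) hk)
    refine ⟨max n₀ (3 ^ (κ + 1)), max n₀ ((c + 3) * ((κ + 1) * 3 ^ (κ + 1))),
      gatherAlgorithm fun n => if n < n₀ then componentRule n else manyTrialsRule c κ n,
      fun V _ _ G => ?_⟩
    by_cases hn : Fintype.card V < n₀
    · refine computesDecomposition_componentRule G c _ (if_pos hn)
        (hn.le.trans (le_max_left _ _)) ?_ ?_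
      · exact Real.one_le_rpow (by exact_mod_cast Fintype.card_pos) hδ.le
      · exact_mod_cast hn.le.trans (le_max_left _ _)
    · have h := hn₀ _ (not_lt.1 hn)
      refine computesDecomposition_manyTrialsRule G c κ _ (if_neg hn) h.1 (le_max_right _ _) h.2 ?_
      exact_mod_cast le_max_right n₀ ((c + 3) * ((κ + 1) * 3 ^ (κ + 1)))
  · refine ⟨32 * (c + 2) * (c + 6), fun k => gatherAlgorithm (singleTrialRule c (k - 1)),
      fun V _ _ G k hk hkn => ?_⟩
    obtain ⟨κ, rfl⟩ : ∃ κ, k = κ + 1 := ⟨k - 1, by omega⟩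
    have hlog := one_le_logStar (x := Fintype.card V)
      (by exact_mod_cast two_le_of_le_logb hk hkn)
    have hlog' : (1 : ℝ) ≤ logStar (Fintype.card V) := by exact_mod_cast hlog
    refine computesDecomposition_singleTrialRule G c κ hkn ?_
    have hc : (0 : ℝ) ≤ c := Nat.cast_nonneg c
    gcongr
    · nlinarith
    · exact le_mul_of_one_le_right (by positivity) hlog'
  · refine ⟨16 * (c + 6), fun k => gatherAlgorithm (manyTrialsRule c (k - 1)),
      fun V _ _ G k hk hkn => ?_⟩
    obtain ⟨κ, rfl⟩ : ∃ κ, k = κ + 1 := ⟨k - 1, by omega⟩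
    refine computesDecomposition_manyTrialsRule G c κ _ rfl hkn le_rfl le_rfl ?_
    gcongr
    linarith
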